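/- All objects are $C^\infty$. A contact sub-pseudo-Riemannian structure $(D,g)$ on a $(2n+1)$-dimensional manifold $M$ is a contact distribution $D\subset TM$ with a pseudo-Riemannian metric $g$ (of any signature) on $D$. A contact form $\alpha$ on an open set $U\subset M$ with $\ker\alpha=D$ is called normalised if $|(d\alpha|_D)^{\wedge n}(e_1,\dots,e_{2n})|=1$ for every $g$-orthonormal basis $(e_1,\dots,e_{2n})$ of a fibre of $D$ over $U$ (for $n\ge 1$ such forms exist locally and are unique up to sign on connected sets). Its Reeb field $X_0$ is the vector field on $U$ with $\alpha(X_0)=1$ and $d\alpha(X_0,\cdot)=0$. Put $\omega=-d\alpha|_D$ and $h=\tfrac12\mathcal L_{X_0}g$ (on sections of $D$; note $[X_0,D]\subset D$). A quotient $\pi\colon U\to N=U/X_0$ is a surjective submersion onto a $2n$-dimensional manifold whose fibres are exactly the trajectories of $X_0$ in $U$. **Theorem.** For $i=1,2$ let $(D_i,g_i)$ be a contact sub-pseudo-Riemannian structure on a $(2n+1)$-dimensional manifold $M_i$, let $U_i\subset M_i$ be open, let $\alpha_i$ be a normalised contact form of $(D_i,g_i)$ on $U_i$ with Reeb field $X_0^i$,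 and let $h_i$, $\omega_i$ be as above. Assume $h_i=0$ and $\mathcal L_{X_0^i}\omega_i=0$ on $U_i$, and let $\pi_i\colon U_i\to N_i=U_i/X_0^i$ be the quotient. Then: 1. There are a unique pseudo-Riemannian metric $\tilde g_i$ and a unique $2$-form $\tilde\omega_i$ on $N_i$ (the projections of $g_i$ and $\omega_i$) whose pullbacks under $\pi_i$ coincide on $D_i$ with $g_i$ and $\omega_i$. 2. The projections determine the structure up to local equivalence: if $\varphi$ is a diffeomorphism from an open subset $V_1\subset N_1$ onto an open subset of $N_2$ with $\varphi^*\tilde g_2=\tilde g_1$ and $\varphi^*\tilde\omega_2=\tilde\omega_1$ on $V_1$, and if $p_1\in U_1$, $p_2\in U_2$ satisfy $\pi_1(p_1)\in V_1$ and $\varphi(\pi_1(p_1))=\pi_2(p_2)$, then there is a diffeomorphism $f$ from an open neighbourhood $W_1\subset U_1\cap\pi_1^{-1}(V_1)$ of $p_1$ onto an open neighbourhood $W_2\subset U_2$ of $p_2$ with $f(p_1)=p_2$ and $\pi_2\circ f=\varphi\circ\pi_1$ on $W_1$, which is an isometry of the structures: $df(D_1)=D_2$, and $df\colon D_1\to D_2$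 is a linear isometry from $g_1$ to $g_2$. -/

import Mathlib

open scoped Manifold ContDiff
open Set

noncomputable section

namespace SubPseudo

section Fields

variable {m : ℕ} {M : Type*} [TopologicalSpace M] [ChartedSpace (EuclideanSpace ℝ (Fin m)) M]
  [IsManifold (𝓡 m) ∞ M]

/-- The vector field `X` is smooth on the set `V`. -/
def SmoothFieldOn (X : Π x : M, TangentSpace (𝓡 m) x) (V : Set M) : Prop :=
  ContMDiffOn (𝓡 m) ((𝓡 m).prod 𝓘(ℝ, EuclideanSpace ℝ (Fin m))) ∞
    (fun x => Bundle.TotalSpace.mk' (EuclideanSpace ℝ (Fin m)) x (X x)) V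

/-- The one-form `α` is smooth on the set `V`. -/
def SmoothOneFormOn (α : Π x : M, TangentSpace (𝓡 m) x →L[ℝ] ℝ) (V : Set M) : Prop :=
  ContMDiffOn (𝓡 m) ((𝓡 m).prod 𝓘(ℝ, EuclideanSpace ℝ (Fin m) →L[ℝ] ℝ)) ∞
    (fun x => Bundle.TotalSpace.mk' (EuclideanSpace ℝ (Fin m) →L[ℝ] ℝ)
      (E := fun x : M => TangentSpace (𝓡 m) x →L[ℝ] ℝ) x (α x)) V

/-- The field of bilinear forms `B` on the tangent spaces is smooth. -/
def SmoothBilin (B : Π x : M, TangentSpace (𝓡 m) x →L[ℝ] TangentSpace (𝓡 m) x →L[ℝ] ℝ) : Prop :=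
  ContMDiff (𝓡 m)
    ((𝓡 m).prod 𝓘(ℝ, EuclideanSpace ℝ (Fin m) →L[ℝ] EuclideanSpace ℝ (Fin m) →L[ℝ] ℝ)) ∞
    (fun x => Bundle.TotalSpace.mk'
      (EuclideanSpace ℝ (Fin m) →L[ℝ] EuclideanSpace ℝ (Fin m) →L[ℝ] ℝ)
      (E := fun x : M => TangentSpace (𝓡 m) x →L[ℝ] TangentSpace (𝓡 m) x →L[ℝ] ℝ) x (B x))

/-- A (smooth) pseudo-Riemannian metric. -/
structure IsPseudoRiemannianMetric
    (B : Π x : M, TangentSpace (𝓡 m) x →L[ℝ] TangentSpace (𝓡 m) x →L[ℝ] ℝ) : Prop where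
  smooth : SmoothBilin B
  symm : ∀ x u v, B x u v = B x v u
  nondeg : ∀ x u, (∀ v, B x u v = 0) → u = 0

/-- A (smooth) differential two-form. -/
structure IsTwoForm
    (B : Π x : M, TangentSpace (𝓡 m) x →L[ℝ] TangentSpace (𝓡 m) x →L[ℝ] ℝ) : Prop where
  smooth : SmoothBilin B
  alt : ∀ x u, B x u u = 0

/-- The one-form `α` read in the preferred chart at `x`: the pullback of `α` under the inverse
of the chart, a one-form on the model space. -/
def chartForm (α : Π x : M, TangentSpace (𝓡 m) x →L[ℝ] ℝ) (x : M) :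
    EuclideanSpace ℝ (Fin m) → EuclideanSpace ℝ (Fin m) →L[ℝ] ℝ :=
  fun e => (α ((extChartAt (𝓡 m) x).symm e)).comp
    (mfderiv 𝓘(ℝ, EuclideanSpace ℝ (Fin m)) (𝓡 m) (extChartAt (𝓡 m) x).symm e)

/-- The exterior derivative of the one-form `α` at `x`, evaluated on `u, v`; with the convention
`dα(X,Y) = X(α(Y)) - Y(α(X)) - α([X,Y])`. It is computed in the preferred chart at `x`. -/
def extDerivForm (α : Π x : M, TangentSpace (𝓡 m) x →L[ℝ] ℝ) (x : M)
    (u v : TangentSpace (𝓡 m) x) : ℝ :=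
  let A := fderiv ℝ (chartForm α x) (extChartAt (𝓡 m) x x)
  let D := mfderiv (𝓡 m) 𝓘(ℝ, EuclideanSpace ℝ (Fin m)) (extChartAt (𝓡 m) x) x
  A (D u) (D v) - A (D v) (D u)

/-- The Lie derivative along `Z` of a field `b` of two-tensors, evaluated at `x` on the vector
fields `X, Y`:  `Z(b(X,Y)) - b([Z,X],Y) - b(X,[Z,Y])`. -/
def lieDeriv (Z : Π x : M, TangentSpace (𝓡 m) x)
    (b : Π x : M, TangentSpace (𝓡 m) x → TangentSpace (𝓡 m) x → ℝ)
    (X Y : Π x : M, TangentSpace (𝓡 m) x) (x : M) : ℝ :=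
  (show ℝ from mfderiv (𝓡 m) 𝓘(ℝ, ℝ) (fun y => b y (X y) (Y y)) x (Z x))
    - b x (VectorField.mlieBracket (𝓡 m) Z X x) (Y x)
    - b x (X x) (VectorField.mlieBracket (𝓡 m) Z Y x)

/-- `X` is a smooth section over the open set `V` of the distribution `D`. -/
structure IsSectionOn (D : Π x : M, Submodule ℝ (TangentSpace (𝓡 m) x))
    (X : Π x : M, TangentSpace (𝓡 m) x) (V : Set M) : Prop where
  smooth : SmoothFieldOn X V
  mem : ∀ x ∈ V, X x ∈ D x

/-- On `V`, the smooth one-form `α` is a contact form with kernel `D`: it annihilates exactly `D`,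
and `dα` is nondegenerate on `D`. -/
structure IsContactFormOn (D : Π x : M, Submodule ℝ (TangentSpace (𝓡 m) x))
    (α : Π x : M, TangentSpace (𝓡 m) x →L[ℝ] ℝ) (V : Set M) : Prop where
  smooth : SmoothOneFormOn α V
  ne_zero : ∀ x ∈ V, α x ≠ 0
  ker : ∀ x ∈ V, ∀ u, u ∈ D x ↔ α x u = 0
  nondeg : ∀ x ∈ V, ∀ u ∈ D x, (∀ v ∈ D x, extDerivForm α x u v = 0) → u = 0

open Classical in
/-- The bilinear form `g` on the distribution `D`, evaluated on arbitrary tangent vectors at `x`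
(with the irrelevant value `0` if one of them is not in `D`). -/
def onVectors (D : Π x : M, Submodule ℝ (TangentSpace (𝓡 m) x))
    (g : Π x : M, D x →ₗ[ℝ] D x →ₗ[ℝ] ℝ) (x : M) (u v : TangentSpace (𝓡 m) x) : ℝ :=
  if h : u ∈ D x ∧ v ∈ D x then g x ⟨u, h.1⟩ ⟨v, h.2⟩ else 0

end Fields

/-- The value on `e₀, …, e₂ₙ₋₁` of the `n`-th exterior power of a skew form `b`:
`(1/2ⁿ) ∑_σ sgn(σ) ∏_i b(e_{σ(2i)}, e_{σ(2i+1)})`. -/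
def wedgePow {V : Type*} (n : ℕ) (b : V → V → ℝ) (e : Fin (2 * n) → V) : ℝ :=
  (1 / 2 ^ n : ℝ) * ∑ σ : Equiv.Perm (Fin (2 * n)), ((Equiv.Perm.sign σ : ℤ) : ℝ) *
    ∏ i : Fin n, b (e (σ ⟨2 * i, by omega⟩)) (e (σ ⟨2 * i + 1, by omega⟩))

/-- A contact sub-pseudo-Riemannian structure `(D, g)` on a manifold `M` of dimension `2n+1`:
a contact distribution `D` with a smooth nondegenerate symmetric bilinear form `g` on `D`. -/
structure ContactStructure (n : ℕ) (M : Type*) [TopologicalSpace M]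
    [ChartedSpace (EuclideanSpace ℝ (Fin (2 * n + 1))) M] [IsManifold (𝓡 (2 * n + 1)) ∞ M] where
  /-- The contact distribution. -/
  D : Π x : M, Submodule ℝ (TangentSpace (𝓡 (2 * n + 1)) x)
  contact : ∀ x : M, ∃ V : Set M, IsOpen V ∧ x ∈ V ∧ ∃ α, IsContactFormOn D α V
  /-- The metric on the distribution. -/
  g : Π x : M, D x →ₗ[ℝ] D x →ₗ[ℝ] ℝ
  symm : ∀ x u v, g x u v = g x v u
  nondeg : ∀ x u, (∀ v, g x u v = 0) → u = 0
  smooth : ∀ (V : Set M) (X Y : Π x : M, TangentSpace (𝓡 (2 * n + 1)) x), IsOpen V →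
    IsSectionOn D X V → IsSectionOn D Y V →
      ContMDiffOn (𝓡 (2 * n + 1)) 𝓘(ℝ, ℝ) ∞ (fun x => onVectors D g x (X x) (Y x)) V

section Reeb

variable {n : ℕ} {M : Type*} [TopologicalSpace M]
  [ChartedSpace (EuclideanSpace ℝ (Fin (2 * n + 1))) M] [IsManifold (𝓡 (2 * n + 1)) ∞ M]

/-- The metric of the structure, evaluated on vectors of the distribution. -/
def ContactStructure.metric (S : ContactStructure n M) (x : M)
    (u v : TangentSpace (𝓡 (2 * n + 1)) x) : ℝ :=
  onVectors S.D S.g x u v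

/-- `e` is an orthonormal basis of `D x`: `g(eᵢ,eⱼ) = 0` for `i ≠ j`, and `g(eᵢ,eᵢ) = ±1`. -/
def ContactStructure.IsOrthonormalBasis (S : ContactStructure n M) (x : M)
    (e : Module.Basis (Fin (2 * n)) ℝ (S.D x)) : Prop :=
  (∀ i j, i ≠ j → S.g x (e i) (e j) = 0) ∧ ∀ i, S.g x (e i) (e i) = 1 ∨ S.g x (e i) (e i) = -1

/-- `α` is a normalised contact form of the structure on `U`: a contact form annihilating `D` such
that `(dα|_D)^{∧n}` has value `±1` on orthonormal bases of `D`. -/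
structure IsNormalizedContactForm (S : ContactStructure n M) (U : Set M)
    (α : Π x : M, TangentSpace (𝓡 (2 * n + 1)) x →L[ℝ] ℝ) : Prop where
  contact : IsContactFormOn S.D α U
  norm : ∀ x ∈ U, ∀ e, S.IsOrthonormalBasis x e →
    |wedgePow n (extDerivForm α x) (fun i => (e i : TangentSpace (𝓡 (2 * n + 1)) x))| = 1

/-- `X₀` is the Reeb vector field of `α` on `U`. -/
structure IsReebField (U : Set M) (α : Π x : M, TangentSpace (𝓡 (2 * n + 1)) x →L[ℝ] ℝ)
    (X₀ : Π x : M, TangentSpace (𝓡 (2 * n + 1)) x) : Prop where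
  smooth : SmoothFieldOn X₀ U
  one : ∀ x ∈ U, α x (X₀ x) = 1
  ker : ∀ x ∈ U, ∀ u, extDerivForm α x (X₀ x) u = 0

/-- The form `ω = -dα`; only its values on vectors of the distribution are used. -/
def omegaForm (α : Π x : M, TangentSpace (𝓡 (2 * n + 1)) x →L[ℝ] ℝ) (x : M)
    (u v : TangentSpace (𝓡 (2 * n + 1)) x) : ℝ :=
  -extDerivForm α x u v

/-- The form `h = ½ L_{X₀} g` at `x`, evaluated on sections `X, Y` of the distribution. -/
def hForm (S : ContactStructure n M) (X₀ X Y : Π x : M, TangentSpace (𝓡 (2 * n + 1)) x)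
    (x : M) : ℝ :=
  (1 / 2) * lieDeriv X₀ S.metric X Y x

/-- `h = 0` on `U`. -/
def HVanishesOn (S : ContactStructure n M) (U : Set M)
    (X₀ : Π x : M, TangentSpace (𝓡 (2 * n + 1)) x) : Prop :=
  ∀ V X Y, IsOpen V → V ⊆ U → IsSectionOn S.D X V → IsSectionOn S.D Y V →
    ∀ x ∈ V, hForm S X₀ X Y x = 0

/-- `L_{X₀} ω = 0` on `U`, where `ω = -dα` is considered as a form on the distribution. -/
def OmegaInvariantOn (S : ContactStructure n M) (U : Set M)
    (α : Π x : M, TangentSpace (𝓡 (2 * n + 1)) x →L[ℝ] ℝ)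
    (X₀ : Π x : M, TangentSpace (𝓡 (2 * n + 1)) x) : Prop :=
  ∀ V X Y, IsOpen V → V ⊆ U → IsSectionOn S.D X V → IsSectionOn S.D Y V →
    ∀ x ∈ V, lieDeriv X₀ (omegaForm α) X Y x = 0

/-- `x` and `y` lie on the same trajectory of `X₀` in `U`. -/
def SameTrajectory (U : Set M) (X₀ : Π x : M, TangentSpace (𝓡 (2 * n + 1)) x) (x y : M) : Prop :=
  ∃ (γ : ℝ → M) (a b : ℝ), IsMIntegralCurveOn γ X₀ (uIcc a b) ∧ MapsTo γ (uIcc a b) U ∧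
    γ a = x ∧ γ b = y

variable {N : Type*} [TopologicalSpace N] [ChartedSpace (EuclideanSpace ℝ (Fin (2 * n))) N]
  [IsManifold (𝓡 (2 * n)) ∞ N]

/-- `π : U → N` exhibits the `2n`-dimensional manifold `N` as the quotient `U / X₀` of the open
set `U` by the trajectories of `X₀`: it is a surjective submersion whose fibres are exactly the
trajectories of `X₀` in `U`. -/
structure IsQuotient (U : Set M) (X₀ : Π x : M, TangentSpace (𝓡 (2 * n + 1)) x) (π : M → N) :
    Prop where
  isOpen : IsOpen U
  smooth : ContMDiffOn (𝓡 (2 * n + 1)) (𝓡 (2 * n)) ∞ π U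
  submersion : ∀ x ∈ U, Function.Surjective (mfderiv (𝓡 (2 * n + 1)) (𝓡 (2 * n)) π x)
  surjective : π '' U = univ
  fibre : ∀ x ∈ U, ∀ y ∈ U, π x = π y ↔ SameTrajectory U X₀ x y

/-- The pullback of `B` under `π` coincides on the distribution with `b`. -/
def PullsBackOnD (S : ContactStructure n M) (U : Set M) (π : M → N)
    (B : Π y : N, TangentSpace (𝓡 (2 * n)) y →L[ℝ] TangentSpace (𝓡 (2 * n)) y →L[ℝ] ℝ)
    (b : Π x : M, TangentSpace (𝓡 (2 * n + 1)) x → TangentSpace (𝓡 (2 * n + 1)) x → ℝ) : Prop :=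
  ∀ x ∈ U, ∀ u ∈ S.D x, ∀ v ∈ S.D x,
    B (π x) (mfderiv (𝓡 (2 * n + 1)) (𝓡 (2 * n)) π x u)
      (mfderiv (𝓡 (2 * n + 1)) (𝓡 (2 * n)) π x v) = b x u v

/-- `gN` is a projection of the metric of the structure to `N`. -/
structure IsMetricProjection (S : ContactStructure n M) (U : Set M) (π : M → N)
    (gN : Π y : N, TangentSpace (𝓡 (2 * n)) y →L[ℝ] TangentSpace (𝓡 (2 * n)) y →L[ℝ] ℝ) :
    Prop where
  metric : IsPseudoRiemannianMetric gN
  pullback : PullsBackOnD S U π gN S.metric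

/-- `ΩN` is a projection of `ω = -dα` to `N`. -/
structure IsOmegaProjection (S : ContactStructure n M) (U : Set M)
    (α : Π x : M, TangentSpace (𝓡 (2 * n + 1)) x →L[ℝ] ℝ) (π : M → N)
    (ΩN : Π y : N, TangentSpace (𝓡 (2 * n)) y →L[ℝ] TangentSpace (𝓡 (2 * n)) y →L[ℝ] ℝ) :
    Prop where
  form : IsTwoForm ΩN
  pullback : PullsBackOnD S U π ΩN (omegaForm α)

/-- The symmetric case: on the open set `U`, a normalised contact form `α`
of `(D, g)` with Reeb field `X₀`, such that `h = 0` and `L_{X₀} ω = 0`, and the quotient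
`π : U → N` by the trajectories of `X₀`. -/
structure IsSymmetricQuotient (S : ContactStructure n M) (U : Set M)
    (α : Π x : M, TangentSpace (𝓡 (2 * n + 1)) x →L[ℝ] ℝ)
    (X₀ : Π x : M, TangentSpace (𝓡 (2 * n + 1)) x) (π : M → N) : Prop where
  normalized : IsNormalizedContactForm S U α
  reeb : IsReebField U α X₀
  h_zero : HVanishesOn S U X₀
  omega_inv : OmegaInvariantOn S U α X₀
  quotient : IsQuotient U X₀ π

end Reeb

section Maps

variable {m : ℕ} {M₁ M₂ : Type*}
  [TopologicalSpace M₁] [ChartedSpace (EuclideanSpace ℝ (Fin m)) M₁]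
  [TopologicalSpace M₂] [ChartedSpace (EuclideanSpace ℝ (Fin m)) M₂]

/-- `f` is a diffeomorphism between its (open) source and its (open) target. -/
structure IsDiffeo (f : OpenPartialHomeomorph M₁ M₂) : Prop where
  smooth : ContMDiffOn (𝓡 m) (𝓡 m) ∞ f f.source
  smooth_symm : ContMDiffOn (𝓡 m) (𝓡 m) ∞ f.symm f.target

/-- The pullback of `B₂` under `f` is `B₁` on the source of `f`. -/
def PullsBack (f : OpenPartialHomeomorph M₁ M₂)
    (B₂ : Π y : M₂, TangentSpace (𝓡 m) y →L[ℝ] TangentSpace (𝓡 m) y →L[ℝ] ℝ)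
    (B₁ : Π y : M₁, TangentSpace (𝓡 m) y →L[ℝ] TangentSpace (𝓡 m) y →L[ℝ] ℝ) : Prop :=
  ∀ y ∈ f.source, ∀ u v : TangentSpace (𝓡 m) y,
    B₂ (f y) (mfderiv (𝓡 m) (𝓡 m) f y u) (mfderiv (𝓡 m) (𝓡 m) f y v) = B₁ y u v

end Maps

/-- The local diffeomorphism `f` is an isometry of contact sub-pseudo-Riemannian structures on its
source: its differential maps `D₁` onto `D₂` and is there a linear isometry of the metrics. -/
structure IsSubIsometry {n : ℕ} {M₁ M₂ : Type*}
    [TopologicalSpace M₁] [ChartedSpace (EuclideanSpace ℝ (Fin (2 * n + 1))) M₁]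
    [IsManifold (𝓡 (2 * n + 1)) ∞ M₁]
    [TopologicalSpace M₂] [ChartedSpace (EuclideanSpace ℝ (Fin (2 * n + 1))) M₂]
    [IsManifold (𝓡 (2 * n + 1)) ∞ M₂]
    (S₁ : ContactStructure n M₁) (S₂ : ContactStructure n M₂)
    (f : OpenPartialHomeomorph M₁ M₂) : Prop where
  diffeo : IsDiffeo (m := 2 * n + 1) f
  map_D : ∀ x ∈ f.source,
    (S₁.D x).map (mfderiv (𝓡 (2 * n + 1)) (𝓡 (2 * n + 1)) f x).toLinearMap = S₂.D (f x)
  isometry : ∀ x ∈ f.source, ∀ u ∈ S₁.D x, ∀ v ∈ S₁.D x,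
    S₂.metric (f x) (mfderiv (𝓡 (2 * n + 1)) (𝓡 (2 * n + 1)) f x u)
      (mfderiv (𝓡 (2 * n + 1)) (𝓡 (2 * n + 1)) f x v) = S₁.metric x u v

end SubPseudo

end

/-! Over `U` the tangent space splits as `D ⊕ ℝX₀`; `dπ` kills `X₀` and maps `D` isomorphically onto
the tangent space of `N`. A vector field on `N` that is constant in a chart thus has a unique
horizontal lift `W` in `D`. As `W` is projectable, `X₀` projects to `0` and `dα(X₀,·) = 0`, the
bracket `[X₀, W]` is killed by both `dπ` and `α`, so it vanishes (`mlieBracket_reeb_hlift`). For `b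
= g` or `b = ω`, the condition `L_{X₀} b = 0` then says that `b(W, W')` has zero derivative along
`X₀`. It is therefore constant on trajectories, which are the fibres of `π`, and `b` descends
(`apply_hlift_eq`, `exists_projection`). Uniqueness holds because `D` surjects onto the tangent
spaces of `N`.

For the equivalence, `dα = -π^*Ω` on all tangent vectors, since `X₀` lies in the kernel of both
sides (`extDerivForm_eq_pullback`). Form the fibre product of `M₁` and `M₂` over `N₂` by means of `φ
∘ π₁` and `π₂`. There the difference `β` of the pullbacks of `α₂` and `α₁` is closed, so locally `β
= dG` with `G` zero at `(p₁, p₂)`. Since `β` does not vanish along the fibres of the projection to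
`M₁`, the set `G = 0` is the graph of a map `f` covering `φ`, and `β` restricts to `0` on it, which
means `f^*α₂ = α₁` (`exists_local_equivalence`). Hence `f` carries `ker α₁ = D₁` to `D₂`; it is an
isometry there because it covers `φ`, which matches the projected metrics (`exists_local_isometry`).
-/

noncomputable section

namespace SubPseudo

set_option linter.unusedSectionVars false

/-! ### Local analysis in normed spaces: inverse functions, primitives, the graph construction. -/

section Calculus

open Filter Topology

variable {E E₁ E₂ F : Type*} [NormedAddCommGroup E] [NormedSpace ℝ E]
  [NormedAddCommGroup E₁] [NormedSpace ℝ E₁] [NormedAddCommGroup E₂] [NormedSpace ℝ E₂]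
  [NormedAddCommGroup F] [NormedSpace ℝ F]

theorem two_le_infty : (2 : ℕ∞ω) ≤ ∞ := WithTop.coe_le_coe.2 (le_top : (2 : ℕ∞) ≤ ⊤)

/-- The product rule for a constant pairing: derivatives of the field are traded for derivatives of
the form. This is how brackets of fields with prescribed pairings are computed. -/
theorem apply_fderiv_of_eventually_const {A : E → E →L[ℝ] F} {Y : E → E} {x : E} {c : F}
    (hA : DifferentiableAt ℝ A x) (hY : DifferentiableAt ℝ Y x)
    (h : ∀ᶠ y in 𝓝 x, A y (Y y) = c) (u : E) :
    A x (fderiv ℝ Y x u) = -fderiv ℝ A x u (Y x) := by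
  have h1 := (hA.hasFDerivAt.clm_apply hY.hasFDerivAt).fderiv
  have h2 : fderiv ℝ (fun y => A y (Y y)) x = 0 := by
    have : (fun y => A y (Y y)) =ᶠ[𝓝 x] fun _ => c := h
    rw [this.fderiv_eq]; simp
  rw [h2] at h1
  have h3 := DFunLike.congr_fun h1 u
  simp at h3
  exact eq_neg_of_add_eq_zero_left h3.symm

theorem contDiffAt_clm_prod {G : Type*} [NormedAddCommGroup G] [NormedSpace ℝ G]
    {f : E → E₁ →L[ℝ] F} {g : E → E₁ →L[ℝ] G} {x : E} (hf : ContDiffAt ℝ ∞ f x)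
    (hg : ContDiffAt ℝ ∞ g x) : ContDiffAt ℝ ∞ (fun y => (f y).prod (g y)) x :=
  ((ContinuousLinearMap.prodₗᵢ ℝ :
    ((E₁ →L[ℝ] F) × (E₁ →L[ℝ] G)) ≃ₗᵢ[ℝ] (E₁ →L[ℝ] F × G)).contDiff.contDiffAt).comp x
      (hf.prodMk hg)

theorem eventually_isInvertible [CompleteSpace E] {X : Type*} [TopologicalSpace X]
    {A : X → E →L[ℝ] F} {x : X} (hA : ContinuousAt A x) (hinv : (A x).IsInvertible) :
    ∀ᶠ y in 𝓝 x, (A y).IsInvertible := by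
  obtain ⟨e, he⟩ := hinv
  have h := ContinuousLinearEquiv.nhds e
  rw [he] at h
  filter_upwards [hA h] with y hy
  obtain ⟨e', he'⟩ := hy
  exact ⟨e', he'⟩

/-- The inverse function theorem for maps which are smooth near a point. -/
theorem exists_smooth_inverse [CompleteSpace E] {f : E → F} {x : E}
    (hf : ∀ᶠ y in 𝓝 x, ContDiffAt ℝ ∞ f y) (hinv : (fderiv ℝ f x).IsInvertible) :
    ∃ Φ : OpenPartialHomeomorph E F, x ∈ Φ.source ∧ (∀ y, Φ y = f y) ∧
      (∀ y ∈ Φ.source, ContDiffAt ℝ ∞ f y ∧ (fderiv ℝ f y).IsInvertible) ∧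
      ∀ z ∈ Φ.target, ContDiffAt ℝ ∞ Φ.symm z := by
  have hfx := hf.self_of_nhds
  have hc : ContinuousAt (fderiv ℝ f) x := (hfx.fderiv_right (m := 0) (by simp)).continuousAt
  have hev := hf.and (eventually_isInvertible hc hinv)
  obtain ⟨O, hO, hOo, hxO⟩ := eventually_nhds_iff.1 hev
  obtain ⟨e, he⟩ := hinv
  have hd : HasFDerivAt f (e : E →L[ℝ] F) x := by
    rw [he]; exact (hfx.differentiableAt (by simp)).hasFDerivAt
  -- Shrinking to `O`, where `f` is smooth with invertible derivative, makes the inverse smooth at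
  -- every point of the target and not only at `f x`.
  let Φ := (hfx.toOpenPartialHomeomorph f hd (by simp)).restrOpen O hOo
  refine ⟨Φ, ⟨hfx.mem_toOpenPartialHomeomorph_source hd (by simp), hxO⟩, fun _ => rfl,
    fun y hy => hO y hy.2, fun z hz => ?_⟩
  have hy : Φ.symm z ∈ Φ.source := Φ.map_target hz
  obtain ⟨h1, e', he'⟩ := hO _ hy.2
  refine Φ.contDiffAt_symm hz (f₀' := e') ?_ h1
  rw [he']
  exact (h1.differentiableAt (by simp)).hasFDerivAt

/-- A primitive of a closed smooth one-form near a point. -/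
theorem exists_primitive {β : E → E →L[ℝ] ℝ} {q : E} (hβ : ∀ᶠ y in 𝓝 q, ContDiffAt ℝ ∞ β y)
    (hd : ∀ᶠ y in 𝓝 q, ∀ u v, fderiv ℝ β y u v = fderiv ℝ β y v u) :
    ∃ G : E → ℝ, G q = 0 ∧ ∀ᶠ y in 𝓝 q, ContDiffAt ℝ ∞ G y ∧ HasFDerivAt G (β y) y := by
  obtain ⟨r, hr, hb⟩ := Metric.eventually_nhds_iff_ball.1 (hβ.and hd)
  obtain ⟨G, hG⟩ := (convex_ball q r).exists_forall_hasFDerivAt_of_fderiv_symmetric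
    Metric.isOpen_ball (fun y hy => ((hb y hy).1.differentiableAt (by simp)).differentiableWithinAt)
    (fun y hy => (hb y hy).2)
  have hs : ContDiffOn ℝ ∞ G (Metric.ball q r) := by
    rw [contDiffOn_infty_iff_fderiv_of_isOpen Metric.isOpen_ball]
    refine ⟨fun y hy => (hG y hy).differentiableAt.differentiableWithinAt, ?_⟩
    exact ContDiffOn.congr (fun y hy => (hb y hy).1.contDiffWithinAt)
      (fun y hy => (hG y hy).fderiv)
  refine ⟨fun y => G y - G q, sub_self _, ?_⟩
  filter_upwards [Metric.ball_mem_nhds q hr] with y hy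
  exact ⟨(hs.contDiffAt (Metric.isOpen_ball.mem_nhds hy)).sub contDiffAt_const,
    (hG y hy).sub_const _⟩

/-- The antisymmetrised derivative of the pullback of a one-form under a map. -/
theorem fderiv_pullback_antisymm {a : F → F →L[ℝ] ℝ} {Q : E → F} {q : E}
    (ha : DifferentiableAt ℝ a (Q q)) (hQ : ContDiffAt ℝ ∞ Q q) (u v : E) :
    fderiv ℝ (fun y => (a (Q y)).comp (fderiv ℝ Q y)) q u v
      - fderiv ℝ (fun y => (a (Q y)).comp (fderiv ℝ Q y)) q v u =
    fderiv ℝ a (Q q) (fderiv ℝ Q q u) (fderiv ℝ Q q v)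
      - fderiv ℝ a (Q q) (fderiv ℝ Q q v) (fderiv ℝ Q q u) := by
  have hQ' : DifferentiableAt ℝ (fderiv ℝ Q) q :=
    (hQ.fderiv_right (m := 1) (by rw [one_add_one_eq_two]; exact two_le_infty)).differentiableAt (by simp)
  have h := (ha.hasFDerivAt.comp q (hQ.differentiableAt (by simp)).hasFDerivAt).clm_comp
    hQ'.hasFDerivAt
  -- The only term that is not a pullback is `a (D²Q(u, v))`; it is symmetric and cancels. This is
  -- `d(Q^*a) = Q^*(da)`.
  have hsymm : fderiv ℝ (fderiv ℝ Q) q u v = fderiv ℝ (fderiv ℝ Q) q v u :=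
    (hQ.isSymmSndFDerivAt (by simpa using two_le_infty)).eq u v
  have h2 := h.fderiv
  simp only [Function.comp_def] at h2
  rw [h2]
  simp [hsymm]

/-- Two one-forms `a₁`, `a₂` whose differentials correspond to each other under the submersions
`R` and `P` are related by a local diffeomorphism over the base. -/
theorem exists_local_equivalence [FiniteDimensional ℝ E₁] [FiniteDimensional ℝ E₂]
    {a₁ : E₁ → E₁ →L[ℝ] ℝ} {a₂ : E₂ → E₂ →L[ℝ] ℝ} {R : E₁ → F} {P : E₂ → F} {x₁ : E₁} {x₂ : E₂}
    (ha₁ : ∀ᶠ x in 𝓝 x₁, ContDiffAt ℝ ∞ a₁ x) (ha₂ : ∀ᶠ x in 𝓝 x₂, ContDiffAt ℝ ∞ a₂ x)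
    (hR : ∀ᶠ x in 𝓝 x₁, ContDiffAt ℝ ∞ R x) (hP : ∀ᶠ x in 𝓝 x₂, ContDiffAt ℝ ∞ P x)
    (hx : R x₁ = P x₂)
    (hinv₁ : ((fderiv ℝ R x₁).prod (a₁ x₁)).IsInvertible)
    (hinv₂ : ((fderiv ℝ P x₂).prod (a₂ x₂)).IsInvertible)
    (hd : ∀ᶠ p in 𝓝 (x₁, x₂), R p.1 = P p.2 → ∀ u v u' v',
      fderiv ℝ R p.1 u = fderiv ℝ P p.2 u' → fderiv ℝ R p.1 v = fderiv ℝ P p.2 v' →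
      fderiv ℝ a₁ p.1 u v - fderiv ℝ a₁ p.1 v u = fderiv ℝ a₂ p.2 u' v' - fderiv ℝ a₂ p.2 v' u') :
    ∃ f : E₁ → E₂, (∀ᶠ x in 𝓝 x₁, ContDiffAt ℝ ∞ f x) ∧ f x₁ = x₂ ∧
      (fderiv ℝ f x₁).IsInvertible ∧
      ∀ᶠ x in 𝓝 x₁, P (f x) = R x ∧ (a₂ (f x)).comp (fderiv ℝ f x) = a₁ x := by
  have : CompleteSpace E₁ := FiniteDimensional.complete ℝ E₁
  have : CompleteSpace E₂ := FiniteDimensional.complete ℝ E₂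
  -- a local trivialisation of `P`
  have hPd : HasFDerivAt P (fderiv ℝ P x₂) x₂ :=
    (hP.self_of_nhds.differentiableAt (by simp)).hasFDerivAt
  -- The fibre coordinate is the covector `a₂ x₂`, frozen at `x₂` and used as a linear function, so
  -- that the derivative at `x₂` is exactly the map in `hinv₂`.
  obtain ⟨Θ, hΘs, hΘ, -, hΘi⟩ := exists_smooth_inverse
    (f := fun z => (P z, a₂ x₂ z)) (x := x₂)
    (by filter_upwards [hP] with z hz using hz.prodMk (a₂ x₂).contDiff.contDiffAt)
    (by rw [(hPd.prodMk (a₂ x₂).hasFDerivAt).fderiv]; exact hinv₂)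
  set s₀ : ℝ := a₂ x₂ x₂ with hs₀
  set q₀ : E₁ × ℝ := (x₁, s₀) with hq₀
  -- `Q (x, s)` is the point over `R x` with fibre coordinate `s`; thus `(x, s) ↦ (x, Q (x, s))`
  -- parametrises the fibre product of `R` and `P` near `(x₁, x₂)`.
  set Q : E₁ × ℝ → E₂ := fun q => Θ.symm (R q.1, q.2) with hQdef
  have hΘx : Θ x₂ = (R x₁, s₀) := by rw [hΘ, hx]
  have hQ0 : Q q₀ = x₂ := by
    change Θ.symm (R x₁, s₀) = x₂
    rw [← hΘx, Θ.left_inv hΘs]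
  have hRc : ContinuousAt R x₁ := hR.self_of_nhds.continuousAt
  have hRq : ContinuousAt (fun q : E₁ × ℝ => (R q.1, q.2)) q₀ :=
    (ContinuousAt.comp (f := Prod.fst) (g := R) (x := q₀) hRc continuousAt_fst).prodMk
      continuousAt_snd
  have htar : ∀ᶠ q in 𝓝 q₀, (R q.1, q.2) ∈ Θ.target := by
    refine hRq.eventually (Θ.open_target.mem_nhds ?_)
    change (R x₁, s₀) ∈ Θ.target
    rw [← hΘx]; exact Θ.map_source hΘs
  have hfst : Tendsto Prod.fst (𝓝 q₀) (𝓝 x₁) := continuousAt_fst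
  have hQs : ∀ᶠ q in 𝓝 q₀, ContDiffAt ℝ ∞ Q q := by
    filter_upwards [htar, hfst.eventually hR] with q h1 h2
    exact (hΘi _ h1).comp q ((h2.comp q contDiffAt_fst).prodMk contDiffAt_snd)
  have hQP : ∀ᶠ q in 𝓝 q₀, P (Q q) = R q.1 ∧ a₂ x₂ (Q q) = q.2 := by
    filter_upwards [htar] with q h1
    have := Θ.right_inv h1
    rw [hΘ] at this
    exact Prod.ext_iff.1 this
  have hQt : Tendsto Q (𝓝 q₀) (𝓝 x₂) := by
    have := hQs.self_of_nhds.continuousAt.tendsto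
    rwa [hQ0] at this
  have ha₂Q : ∀ᶠ q in 𝓝 q₀, ContDiffAt ℝ ∞ a₂ (Q q) := hQt.eventually ha₂
  have ha₁q : ∀ᶠ q in 𝓝 q₀, ContDiffAt ℝ ∞ a₁ q.1 := hfst.eventually ha₁
  -- the difference of the two pulled back forms on the fibre product
  set β : E₁ × ℝ → E₁ × ℝ →L[ℝ] ℝ :=
    fun q => (a₂ (Q q)).comp (fderiv ℝ Q q) - (a₁ q.1).comp (fderiv ℝ Prod.fst q) with hβdef
  have hc2 : ∀ q, ContDiffAt ℝ ∞ Q q → ContDiffAt ℝ ∞ a₂ (Q q) →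
      ContDiffAt ℝ ∞ (fun y => (a₂ (Q y)).comp (fderiv ℝ Q y)) q := fun q h1 h2 =>
    (h2.comp q h1).clm_comp (h1.fderiv_right (by simp))
  have hc1 : ∀ q : E₁ × ℝ, ContDiffAt ℝ ∞ a₁ q.1 →
      ContDiffAt ℝ ∞ (fun y : E₁ × ℝ => (a₁ y.1).comp (fderiv ℝ Prod.fst y)) q := fun q h1 =>
    (h1.comp q contDiffAt_fst).clm_comp (ContDiffAt.fderiv_right (n := ∞) (m := ∞) contDiffAt_fst (by simp))
  have hβs : ∀ᶠ q in 𝓝 q₀, ContDiffAt ℝ ∞ β q := by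
    filter_upwards [hQs, ha₂Q, ha₁q] with q h1 h2 h3
    exact (hc2 q h1 h2).sub (hc1 q h3)
  -- `dβ` is the pullback of `da₂` minus that of `da₁`. Differentiating `P ∘ Q = R ∘ fst` shows that
  -- `dQ u` and `d(fst) u` have the same projection, so `hd` applies and the two terms cancel.
  have hclosed : ∀ᶠ q in 𝓝 q₀, ∀ u v, fderiv ℝ β q u v = fderiv ℝ β q v u := by
    have hpair : Tendsto (fun q : E₁ × ℝ => (q.1, Q q)) (𝓝 q₀) (𝓝 (x₁, x₂)) :=
      hfst.prodMk_nhds hQt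
    filter_upwards [hQs, ha₂Q, ha₁q, hpair.eventually hd, hQP.eventually_nhds, hfst.eventually hR,
      hQt.eventually hP] with q h1 h2 h3 h4 h5 h6 h7 u v
    have e : fderiv ℝ β q = fderiv ℝ (fun y => (a₂ (Q y)).comp (fderiv ℝ Q y)) q
        - fderiv ℝ (fun y : E₁ × ℝ => (a₁ y.1).comp (fderiv ℝ Prod.fst y)) q :=
      fderiv_fun_sub ((hc2 q h1 h2).differentiableAt (by simp))
        ((hc1 q h3).differentiableAt (by simp))
    have e2 := fderiv_pullback_antisymm (h2.differentiableAt (by simp)) h1 u v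
    have e1 := fderiv_pullback_antisymm (Q := (Prod.fst : E₁ × ℝ → E₁)) (q := q)
      (h3.differentiableAt (by simp)) contDiffAt_fst u v
    have hder : (fderiv ℝ P (Q q)).comp (fderiv ℝ Q q)
        = (fderiv ℝ R q.1).comp (fderiv ℝ Prod.fst q) := by
      rw [← fderiv_comp q (h7.differentiableAt (by simp)) (h1.differentiableAt (by simp)),
        ← fderiv_comp q (h6.differentiableAt (by simp)) differentiableAt_fst]
      exact EventuallyEq.fderiv_eq (h5.mono fun y hy => hy.1)
    have h8 := h4 h5.self_of_nhds.1.symm (fderiv ℝ Prod.fst q u) (fderiv ℝ Prod.fst q v)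
      (fderiv ℝ Q q u) (fderiv ℝ Q q v)
      (DFunLike.congr_fun hder u).symm (DFunLike.congr_fun hder v).symm
    rw [e]
    simp only [_root_.sub_apply]
    linarith
  obtain ⟨G, hG0, hG⟩ := exists_primitive hβs hclosed
  -- the zero set of the primitive is a graph
  have hβ1 : β q₀ (0, 1) = 1 := by
    have h1 := hQs.self_of_nhds.differentiableAt (by simp)
    have h2 : (a₂ x₂).comp (fderiv ℝ Q q₀) = ContinuousLinearMap.snd ℝ E₁ ℝ := by
      rw [← fderiv_snd (𝕜 := ℝ) (p := q₀),
        ← EventuallyEq.fderiv_eq (hQP.mono fun y hy => hy.2)]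
      exact ((a₂ x₂).hasFDerivAt.comp q₀ h1.hasFDerivAt).fderiv.symm
    have h3 := DFunLike.congr_fun h2 (0, 1)
    simp only [ContinuousLinearMap.comp_apply, ContinuousLinearMap.coe_snd'] at h3
    simp [hβdef, hQ0, h3, fderiv_fst]
  have hβt : ∀ t : ℝ, β q₀ (0, t) = t := fun t => by
    have : ((0 : E₁), t) = t • ((0 : E₁), (1 : ℝ)) := by simp
    rw [this, map_smul, hβ1]; simp
  have hGd := hG.self_of_nhds.2
  -- The implicit function theorem for `G = 0`. The derivative `(w₁, w₂) ↦ (w₁, β (w₁, 0) + w₂)` is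
  -- triangular, hence the explicit inverse `(w₁, w₂) ↦ (w₁, w₂ - β (w₁, 0))`.
  obtain ⟨Ψ, hΨs, hΨ, -, hΨi⟩ := exists_smooth_inverse
    (f := fun q : E₁ × ℝ => (q.1, G q)) (x := q₀)
    (by filter_upwards [hG] with q hq using contDiffAt_fst.prodMk hq.1)
    (by
      rw [(hasFDerivAt_fst.prodMk hGd).fderiv]
      refine ContinuousLinearMap.IsInvertible.of_inverse
        (g := (ContinuousLinearMap.fst ℝ E₁ ℝ).prod (ContinuousLinearMap.snd ℝ E₁ ℝ -
          (β q₀).comp ((ContinuousLinearMap.inl ℝ E₁ ℝ).comp (ContinuousLinearMap.fst ℝ E₁ ℝ))))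
        ?_ ?_
      · refine ContinuousLinearMap.ext fun w => ?_
        obtain ⟨w1, w2⟩ := w
        have : (w1, w2 - β q₀ (w1, 0)) = (w1, (0 : ℝ)) + ((0 : E₁), w2 - β q₀ (w1, 0)) := by simp
        simp only [ContinuousLinearMap.comp_apply, ContinuousLinearMap.prod_apply,
          ContinuousLinearMap.coe_fst', _root_.sub_apply,
          ContinuousLinearMap.coe_snd', ContinuousLinearMap.inl_apply,
          ContinuousLinearMap.id_apply]
        rw [this, map_add, hβt]
        simp
      · refine ContinuousLinearMap.ext fun w => ?_
        obtain ⟨w1, w2⟩ := w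
        have : (w1, w2) = (w1, (0 : ℝ)) + ((0 : E₁), w2) := by simp
        simp only [ContinuousLinearMap.comp_apply, ContinuousLinearMap.prod_apply,
          ContinuousLinearMap.coe_fst', _root_.sub_apply,
          ContinuousLinearMap.coe_snd', ContinuousLinearMap.inl_apply,
          ContinuousLinearMap.id_apply]
        rw [this, map_add, hβt]
        simp)
  have hΨq : Ψ q₀ = (x₁, 0) := by rw [hΨ, hG0]
  set ψ : E₁ → E₁ × ℝ := fun x => Ψ.symm (x, 0) with hψdef
  have hψ0 : ψ x₁ = q₀ := by
    change Ψ.symm (x₁, 0) = q₀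
    rw [← hΨq, Ψ.left_inv hΨs]
  have hmem : ∀ᶠ x in 𝓝 x₁, ((x, 0) : E₁ × ℝ) ∈ Ψ.target := by
    have : ContinuousAt (fun x : E₁ => (x, (0 : ℝ))) x₁ := by fun_prop
    refine this.eventually (Ψ.open_target.mem_nhds ?_)
    change (x₁, (0 : ℝ)) ∈ Ψ.target
    rw [← hΨq]; exact Ψ.map_source hΨs
  have hψs : ∀ᶠ x in 𝓝 x₁, ContDiffAt ℝ ∞ ψ x := by
    filter_upwards [hmem] with x h
    exact (hΨi _ h).comp x (contDiffAt_id.prodMk contDiffAt_const)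
  have hψe : ∀ᶠ x in 𝓝 x₁, (ψ x).1 = x ∧ G (ψ x) = 0 := by
    filter_upwards [hmem] with x h
    have := Ψ.right_inv h
    rw [hΨ] at this
    exact Prod.ext_iff.1 this
  have hψt : Tendsto ψ (𝓝 x₁) (𝓝 q₀) := by
    have := hψs.self_of_nhds.continuousAt.tendsto
    rwa [hψ0] at this
  have hfs : ∀ᶠ x in 𝓝 x₁, ContDiffAt ℝ ∞ (fun x => Q (ψ x)) x := by
    filter_upwards [hψs, hψt.eventually hQs] with x h1 h2
    exact h2.comp x h1
  have hkey : ∀ᶠ x in 𝓝 x₁, P (Q (ψ x)) = R x ∧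
      (a₂ (Q (ψ x))).comp (fderiv ℝ (fun x => Q (ψ x)) x) = a₁ x := by
    filter_upwards [hψs, hψt.eventually hQs, hψe.eventually_nhds, hψt.eventually hQP,
      hψt.eventually hG] with x h1 h2 h3 h4 h5
    refine ⟨by rw [h4.1, h3.self_of_nhds.1], ?_⟩
    have hψd := (h1.differentiableAt (by simp)).hasFDerivAt
    -- `G ∘ ψ = 0` near `x`, so its derivative vanishes. As the first component of `ψ` is the
    -- identity, this reads `a₂ ∘ df - a₁ = 0`.
    have e1 : (β (ψ x)).comp (fderiv ℝ ψ x) = 0 := by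
      rw [← (h5.2.comp x hψd).fderiv]
      have : (G ∘ ψ) =ᶠ[𝓝 x] fun _ => (0 : ℝ) := h3.mono fun y hy => hy.2
      rw [this.fderiv_eq]; simp
    have e2 : (ContinuousLinearMap.fst ℝ E₁ ℝ).comp (fderiv ℝ ψ x)
        = ContinuousLinearMap.id ℝ E₁ := by
      rw [← (hasFDerivAt_fst.comp x hψd).fderiv]
      have : (Prod.fst ∘ ψ) =ᶠ[𝓝 x] id := h3.mono fun y hy => hy.1
      rw [this.fderiv_eq]; simp
    have e3 : fderiv ℝ (fun x => Q (ψ x)) x = (fderiv ℝ Q (ψ x)).comp (fderiv ℝ ψ x) :=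
      ((h2.differentiableAt (by simp)).hasFDerivAt.comp x hψd).fderiv
    ext u
    have e1u := DFunLike.congr_fun e1 u
    have e2u := DFunLike.congr_fun e2 u
    simp only [hβdef, fderiv_fst, ContinuousLinearMap.comp_apply, _root_.sub_apply,
      ContinuousLinearMap.id_apply, _root_.zero_apply] at e1u e2u
    rw [e3]
    simp only [ContinuousLinearMap.comp_apply]
    rw [e2u, h3.self_of_nhds.1] at e1u
    linarith
  refine ⟨fun x => Q (ψ x), hfs, by simp only [hψ0, hQ0], ?_, hkey⟩
  have hf0 : Q (ψ x₁) = x₂ := by rw [hψ0, hQ0]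
  have hPc : (fderiv ℝ P x₂).comp (fderiv ℝ (fun x => Q (ψ x)) x₁) = fderiv ℝ R x₁ := by
    have h1 := (hfs.self_of_nhds.differentiableAt (by simp)).hasFDerivAt
    rw [← hf0] at hPd
    have h2 := (hPd.comp x₁ h1).fderiv
    rw [hf0] at h2
    rw [← h2]
    exact EventuallyEq.fderiv_eq (hkey.mono fun y hy => hy.1)
  have hac := hkey.self_of_nhds.2
  simp only [hf0] at hac
  obtain ⟨A₁, hA₁⟩ := hinv₁
  obtain ⟨A₂, hA₂⟩ := hinv₂
  -- The two identities just obtained say `(dP, a₂) ∘ df = (dR, a₁)`, which forces `df` to be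
  -- invertible.
  refine ⟨A₁.trans A₂.symm, ?_⟩
  ext u
  have : A₁ u = A₂ (fderiv ℝ (fun x => Q (ψ x)) x₁ u) := by
    change (A₁ : E₁ →L[ℝ] F × ℝ) u = (A₂ : E₂ →L[ℝ] F × ℝ) _
    rw [hA₁, hA₂]
    exact Prod.ext (DFunLike.congr_fun hPc u).symm (DFunLike.congr_fun hac u).symm
  simp [this]

/-- The bracket of a vector field `V`, which is annihilated by `P` and characteristic for the
one-form `a`, with the horizontal lift `W` of a constant vector field. -/
theorem lieBracket_eq_zero {a : E → E →L[ℝ] ℝ} {P : E → F} {V W : E → E} {x : E} {c : ℝ} {w : F}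
    (ha : DifferentiableAt ℝ a x) (hP : ContDiffAt ℝ ∞ P x) (hV : DifferentiableAt ℝ V x)
    (hW : DifferentiableAt ℝ W x)
    (haV : ∀ᶠ y in 𝓝 x, a y (V y) = c) (haW : ∀ᶠ y in 𝓝 x, a y (W y) = 0)
    (hPV : ∀ᶠ y in 𝓝 x, fderiv ℝ P y (V y) = 0) (hPW : ∀ᶠ y in 𝓝 x, fderiv ℝ P y (W y) = w)
    (hda : ∀ u, fderiv ℝ a x (V x) u - fderiv ℝ a x u (V x) = 0)
    (hinj : ∀ u, fderiv ℝ P x u = 0 → a x u = 0 → u = 0) :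
    VectorField.lieBracket ℝ V W x = 0 := by
  have hP' : DifferentiableAt ℝ (fderiv ℝ P) x :=
    (hP.fderiv_right (m := 1) (by rw [one_add_one_eq_two]; exact two_le_infty)).differentiableAt (by simp)
  have hsymm : fderiv ℝ (fderiv ℝ P) x (V x) (W x) = fderiv ℝ (fderiv ℝ P) x (W x) (V x) :=
    (hP.isSymmSndFDerivAt (by simpa using two_le_infty)).eq _ _
  -- `dP` kills the bracket because `V` and `W` project to the constants `0` and `w` and `D²P` is
  -- symmetric; `a` kills it because `a([V, W]) = -da(V, W) = 0`.
  apply hinj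
  · rw [VectorField.lieBracket, map_sub, apply_fderiv_of_eventually_const hP' hW hPW, apply_fderiv_of_eventually_const hP' hV hPV, hsymm, sub_self]
  · rw [VectorField.lieBracket, map_sub, apply_fderiv_of_eventually_const ha hW haW, apply_fderiv_of_eventually_const ha hV haV]
    have := hda (W x)
    linarith

end Calculus

/-! ### Forms, fields, exterior derivatives and brackets read in charts. -/

section Charts

open Filter Topology

variable {m : ℕ} {M : Type*} [TopologicalSpace M] [ChartedSpace (EuclideanSpace ℝ (Fin m)) M]

/-- The differential of the preferred chart at `p`. -/
abbrev dchart (p x : M) : TangentSpace (𝓡 m) x →L[ℝ] EuclideanSpace ℝ (Fin m) :=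
  mfderiv (𝓡 m) 𝓘(ℝ, EuclideanSpace ℝ (Fin m)) (extChartAt (𝓡 m) p) x

/-- The vector field `X` read in the preferred chart at `p`. -/
def chartField (X : Π x : M, TangentSpace (𝓡 m) x) (p : M) :
    EuclideanSpace ℝ (Fin m) → EuclideanSpace ℝ (Fin m) :=
  fun e => dchart p ((extChartAt (𝓡 m) p).symm e) (X ((extChartAt (𝓡 m) p).symm e))

theorem chartField_apply (X : Π x : M, TangentSpace (𝓡 m) x) {p x : M}
    (hx : x ∈ (extChartAt (𝓡 m) p).source) :
    chartField X p (extChartAt (𝓡 m) p x) = dchart p x (X x) := by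
  rw [chartField, (extChartAt (𝓡 m) p).left_inv hx]

variable [IsManifold (𝓡 m) ∞ M]

theorem isManifold_one (m : ℕ) (M : Type*) [TopologicalSpace M]
    [ChartedSpace (EuclideanSpace ℝ (Fin m)) M] [IsManifold (𝓡 m) ∞ M] : IsManifold (𝓡 m) 1 M :=
  IsManifold.of_le (n := ∞) (m := 1) (I := 𝓡 m) (M := M) (WithTop.coe_le_coe.2 (le_top : (1 : ℕ∞) ≤ ⊤))

theorem isInvertible_dchart {p x : M} (hx : x ∈ (extChartAt (𝓡 m) p).source) :
    (dchart (m := m) p x).IsInvertible :=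
  have := isManifold_one m M
  isInvertible_mfderiv_extChartAt hx

theorem mdifferentiableAt_chart {p x : M} (hx : x ∈ (extChartAt (𝓡 m) p).source) :
    MDifferentiableAt (𝓡 m) 𝓘(ℝ, EuclideanSpace ℝ (Fin m)) (extChartAt (𝓡 m) p) x :=
  have := isManifold_one m M
  mdifferentiableAt_extChartAt (by simpa using hx)

theorem mdifferentiableAt_chart_symm {p : M} {e : EuclideanSpace ℝ (Fin m)}
    (he : e ∈ (extChartAt (𝓡 m) p).target) :
    MDifferentiableAt 𝓘(ℝ, EuclideanSpace ℝ (Fin m)) (𝓡 m) (extChartAt (𝓡 m) p).symm e := by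
  have := isManifold_one m M
  have := mdifferentiableWithinAt_extChartAt_symm he
  rwa [ModelWithCorners.range_eq_univ, mdifferentiableWithinAt_univ] at this

theorem mfderiv_symm_dchart {p x : M} (hx : x ∈ (extChartAt (𝓡 m) p).source)
    (u : TangentSpace (𝓡 m) x) :
    mfderiv 𝓘(ℝ, EuclideanSpace ℝ (Fin m)) (𝓡 m) (extChartAt (𝓡 m) p).symm
      (extChartAt (𝓡 m) p x) (dchart p x u) = u := by
  have := isManifold_one m M
  have := mfderivWithin_extChartAt_symm_comp_mfderiv_extChartAt' hx
  simp only [ModelWithCorners.range_eq_univ, mfderivWithin_univ] at this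
  exact DFunLike.congr_fun this u

theorem chartForm_dchart (α : Π x : M, TangentSpace (𝓡 m) x →L[ℝ] ℝ) {p x : M}
    (hx : x ∈ (extChartAt (𝓡 m) p).source) (u : TangentSpace (𝓡 m) x) :
    chartForm α p (extChartAt (𝓡 m) p x) (dchart p x u) = α x u := by
  have h := mfderiv_symm_dchart hx u
  -- The form is evaluated at a base point that equals `x` only propositionally; the comparison
  -- takes place in the common model space.
  have h2 : ∀ y, y = x → ∀ v : EuclideanSpace ℝ (Fin m),
      (α y : EuclideanSpace ℝ (Fin m) →L[ℝ] ℝ) v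
        = (α x : EuclideanSpace ℝ (Fin m) →L[ℝ] ℝ) v := by
    rintro _ rfl v; rfl
  exact (h2 _ ((extChartAt (𝓡 m) p).left_inv hx) _).trans (congrArg (α x) h)

theorem contMDiffAt_chart {p x : M} (hx : x ∈ (extChartAt (𝓡 m) p).source) :
    ContMDiffAt (𝓡 m) 𝓘(ℝ, EuclideanSpace ℝ (Fin m)) ∞ (extChartAt (𝓡 m) p) x :=
  contMDiffAt_extChartAt' (by simpa using hx)

theorem contMDiffAt_chart_symm {p : M} {e : EuclideanSpace ℝ (Fin m)}
    (he : e ∈ (extChartAt (𝓡 m) p).target) :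
    ContMDiffAt 𝓘(ℝ, EuclideanSpace ℝ (Fin m)) (𝓡 m) ∞ (extChartAt (𝓡 m) p).symm e :=
  (contMDiffOn_extChartAt_symm p).contMDiffAt ((isOpen_extChartAt_target p).mem_nhds he)

theorem contMDiffAt_iff_chart {G : Type*} [NormedAddCommGroup G] [NormedSpace ℝ G] {f : M → G}
    {p x : M} (hx : x ∈ (extChartAt (𝓡 m) p).source) :
    ContMDiffAt (𝓡 m) 𝓘(ℝ, G) ∞ f x ↔
      ContDiffAt ℝ ∞ (fun e => f ((extChartAt (𝓡 m) p).symm e)) (extChartAt (𝓡 m) p x) := by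
  have hl := (extChartAt (𝓡 m) p).left_inv hx
  constructor
  · intro h
    exact contMDiffAt_iff_contDiffAt.1
      (h.comp_of_eq (contMDiffAt_chart_symm ((extChartAt (𝓡 m) p).map_source hx)) hl)
  · intro h
    have := (contMDiffAt_iff_contDiffAt.2 h).comp x (contMDiffAt_chart hx)
    refine this.congr_of_eventuallyEq ?_
    filter_upwards [(isOpen_extChartAt_source p).mem_nhds hx] with y hy
    simp only [Function.comp_apply, (extChartAt (𝓡 m) p).left_inv hy]

theorem fderiv_chart {G : Type*} [NormedAddCommGroup G] [NormedSpace ℝ G] {f : M → G}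
    {p x : M} (hx : x ∈ (extChartAt (𝓡 m) p).source)
    (hf : MDifferentiableAt (𝓡 m) 𝓘(ℝ, G) f x) (u : TangentSpace (𝓡 m) x) :
    fderiv ℝ (fun e => f ((extChartAt (𝓡 m) p).symm e)) (extChartAt (𝓡 m) p x) (dchart p x u)
      = mfderiv (𝓡 m) 𝓘(ℝ, G) f x u := by
  have hl := (extChartAt (𝓡 m) p).left_inv hx
  have h1 : MDifferentiableAt 𝓘(ℝ, EuclideanSpace ℝ (Fin m)) 𝓘(ℝ, G)
      (fun e => f ((extChartAt (𝓡 m) p).symm e)) (extChartAt (𝓡 m) p x) :=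
    by
    rw [← hl] at hf
    exact hf.comp _ (mdifferentiableAt_chart_symm ((extChartAt (𝓡 m) p).map_source hx))
  have h2 := mfderiv_comp x h1 (mdifferentiableAt_chart hx)
  have h3 : ((fun e => f ((extChartAt (𝓡 m) p).symm e)) ∘ extChartAt (𝓡 m) p) =ᶠ[𝓝 x] f := by
    filter_upwards [(isOpen_extChartAt_source p).mem_nhds hx] with y hy
    simp only [Function.comp_apply, (extChartAt (𝓡 m) p).left_inv hy]
  rw [h3.mfderiv_eq] at h2
  have h4 := DFunLike.congr_fun h2 u
  rw [mfderiv_eq_fderiv] at h4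
  exact h4.symm

/-- Smoothness of a section is phrased through the bundle trivialisation, and over the chart domain
the trivialisation of the tangent bundle at `p` is the differential of the chart at `p`. -/
theorem smoothFieldOn_contDiffAt {X : Π x : M, TangentSpace (𝓡 m) x} {V : Set M} (hV : IsOpen V)
    (hX : SmoothFieldOn X V) {p x : M} (hx : x ∈ (extChartAt (𝓡 m) p).source) (hxV : x ∈ V) :
    ContDiffAt ℝ ∞ (chartField X p) (extChartAt (𝓡 m) p x) := by
  have : IsManifold (𝓡 m) 1 M := isManifold_one m M
  have h1 := hX.contMDiffAt (hV.mem_nhds hxV)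
  have hx' : x ∈ (chartAt (EuclideanSpace ℝ (Fin m)) p).source := by simpa using hx
  rw [(trivializationAt (EuclideanSpace ℝ (Fin m)) (TangentSpace (𝓡 m)) p).contMDiffAt_section_iff
    (by simpa using hx')] at h1
  rw [contMDiffAt_iff_chart hx] at h1
  refine h1.congr_of_eventuallyEq ?_
  filter_upwards [(isOpen_extChartAt_target p).mem_nhds ((extChartAt (𝓡 m) p).map_source hx)]
    with e he
  have hy : (extChartAt (𝓡 m) p).symm e ∈ (chartAt (EuclideanSpace ℝ (Fin m)) p).source := by
    simpa using (extChartAt (𝓡 m) p).map_target he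
  rw [chartField, dchart, ← TangentBundle.continuousLinearMapAt_trivializationAt hy]
  exact Bundle.Trivialization.continuousLinearMapAt_apply_of_mem (R := ℝ)
    (trivializationAt (EuclideanSpace ℝ (Fin m)) (TangentSpace (𝓡 m)) p) (by simpa using hy) _

theorem smoothFieldOn_of_contDiffAt {X : Π x : M, TangentSpace (𝓡 m) x} {V : Set M}
    (hX : ∀ x ∈ V, ContDiffAt ℝ ∞ (chartField X x) (extChartAt (𝓡 m) x x)) :
    SmoothFieldOn X V := by
  have : IsManifold (𝓡 m) 1 M := isManifold_one m M
  intro x hxV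
  refine ContMDiffAt.contMDiffWithinAt ?_
  have hx := mem_extChartAt_source (I := 𝓡 m) x
  rw [(trivializationAt (EuclideanSpace ℝ (Fin m)) (TangentSpace (𝓡 m)) x).contMDiffAt_section_iff
    (by simp)]
  rw [contMDiffAt_iff_chart hx]
  refine (hX x hxV).congr_of_eventuallyEq ?_
  filter_upwards [(isOpen_extChartAt_target x).mem_nhds ((extChartAt (𝓡 m) x).map_source hx)]
    with e he
  have hy : (extChartAt (𝓡 m) x).symm e ∈ (chartAt (EuclideanSpace ℝ (Fin m)) x).source := by
    simpa using (extChartAt (𝓡 m) x).map_target he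
  rw [chartField, dchart, ← TangentBundle.continuousLinearMapAt_trivializationAt hy]
  exact (Bundle.Trivialization.continuousLinearMapAt_apply_of_mem (R := ℝ)
    (trivializationAt (EuclideanSpace ℝ (Fin m)) (TangentSpace (𝓡 m)) x) (by simpa using hy)
    _).symm

theorem smoothOneFormOn_contDiffAt {α : Π x : M, TangentSpace (𝓡 m) x →L[ℝ] ℝ} {V : Set M}
    (hV : IsOpen V) (hα : SmoothOneFormOn α V) {p x : M}
    (hx : x ∈ (extChartAt (𝓡 m) p).source) (hxV : x ∈ V) :
    ContDiffAt ℝ ∞ (chartForm α p) (extChartAt (𝓡 m) p x) := by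
  have : IsManifold (𝓡 m) 1 M := isManifold_one m M
  have h1 := hα.contMDiffAt (hV.mem_nhds hxV)
  have hx' : x ∈ (chartAt (EuclideanSpace ℝ (Fin m)) p).source := by simpa using hx
  rw [(trivializationAt (EuclideanSpace ℝ (Fin m) →L[ℝ] ℝ)
    (fun x : M => TangentSpace (𝓡 m) x →L[ℝ] ℝ) p).contMDiffAt_section_iff
    (by simpa using hx')] at h1
  rw [contMDiffAt_iff_chart hx] at h1
  refine h1.congr_of_eventuallyEq ?_
  filter_upwards [(isOpen_extChartAt_target p).mem_nhds ((extChartAt (𝓡 m) p).map_source hx)]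
    with e he
  have hy : (extChartAt (𝓡 m) p).symm e ∈ (chartAt (EuclideanSpace ℝ (Fin m)) p).source := by
    simpa using (extChartAt (𝓡 m) p).map_target he
  rw [hom_trivializationAt_apply]
  refine ContinuousLinearMap.ext fun w => ?_
  obtain ⟨u, rfl⟩ : ∃ u, dchart p ((extChartAt (𝓡 m) p).symm e) u = w :=
    (isInvertible_dchart ((extChartAt (𝓡 m) p).map_target he)).bijective.surjective w
  have e1 := chartForm_dchart α ((extChartAt (𝓡 m) p).map_target he) u
  rw [(extChartAt (𝓡 m) p).right_inv he] at e1
  rw [e1]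
  have htriv : ∀ t : ℝ, (trivializationAt ℝ (Bundle.Trivial M ℝ) p).continuousLinearMapAt ℝ
      ((extChartAt (𝓡 m) p).symm e) t = t := fun t => by simp
  refine ((htriv _).trans (congrArg (α ((extChartAt (𝓡 m) p).symm e)) ?_)).symm
  rw [dchart, ← TangentBundle.continuousLinearMapAt_trivializationAt hy]
  exact Bundle.Trivialization.symmL_continuousLinearMapAt (R := ℝ)
    (trivializationAt (EuclideanSpace ℝ (Fin m)) (TangentSpace (𝓡 m)) p) (by simpa using hy) u

/-- The definition uses a different chart at each point. Since `d` commutes with pullback along the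
transition map, one fixed chart serves all nearby points; both the smoothness of `ω` and the
comparison of two contact forms need this. -/
theorem extDerivForm_eq {α : Π x : M, TangentSpace (𝓡 m) x →L[ℝ] ℝ} {V : Set M}
    (hV : IsOpen V) (hα : SmoothOneFormOn α V) {p x : M}
    (hx : x ∈ (extChartAt (𝓡 m) p).source) (hxV : x ∈ V) (u v : TangentSpace (𝓡 m) x) :
    extDerivForm α x u v =
      fderiv ℝ (chartForm α p) (extChartAt (𝓡 m) p x) (dchart p x u) (dchart p x v)
        - fderiv ℝ (chartForm α p) (extChartAt (𝓡 m) p x) (dchart p x v) (dchart p x u) := by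
  set ψ : EuclideanSpace ℝ (Fin m) → EuclideanSpace ℝ (Fin m) :=
    fun e => extChartAt (𝓡 m) p ((extChartAt (𝓡 m) x).symm e) with hψ
  have hxx := mem_extChartAt_source (I := 𝓡 m) x
  have hψx : ψ (extChartAt (𝓡 m) x x) = extChartAt (𝓡 m) p x := by
    simp only [hψ, (extChartAt (𝓡 m) x).left_inv hxx]
  have hψs : ContDiffAt ℝ ∞ ψ (extChartAt (𝓡 m) x x) :=
    (contMDiffAt_iff_chart hxx).1 (contMDiffAt_chart hx)
  -- The form in the chart at `x` is the pullback, under the transition map, of the form in the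
  -- chart at `p`.
  have hev : chartForm α x =ᶠ[𝓝 (extChartAt (𝓡 m) x x)]
      fun e => (chartForm α p (ψ e)).comp (fderiv ℝ ψ e) := by
    have h1 : ∀ᶠ y in 𝓝 x, y ∈ (extChartAt (𝓡 m) p).source :=
      (isOpen_extChartAt_source p).mem_nhds hx
    have h2 : Tendsto (extChartAt (𝓡 m) x).symm (𝓝 (extChartAt (𝓡 m) x x)) (𝓝 x) := by
      have := (continuousAt_extChartAt_symm (I := 𝓡 m) x).tendsto
      rwa [(extChartAt (𝓡 m) x).left_inv hxx] at this
    filter_upwards [h2.eventually h1, (isOpen_extChartAt_target x).mem_nhds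
      ((extChartAt (𝓡 m) x).map_source hxx)] with e he het
    have hy := (extChartAt (𝓡 m) x).map_target het
    set y := (extChartAt (𝓡 m) x).symm e with hydef
    have hey : e = extChartAt (𝓡 m) x y := ((extChartAt (𝓡 m) x).right_inv het).symm
    refine ContinuousLinearMap.ext fun w => ?_
    obtain ⟨u, rfl⟩ : ∃ u, dchart x y u = w := (isInvertible_dchart hy).bijective.surjective w
    have e3 : ψ e = extChartAt (𝓡 m) p y := rfl
    rw [ContinuousLinearMap.comp_apply, e3, hey, chartForm_dchart α hy,
      fderiv_chart hy (mdifferentiableAt_chart he)]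
    exact (chartForm_dchart α he u).symm
  have hαs := smoothOneFormOn_contDiffAt hV hα hx hxV
  rw [← hψx] at hαs
  have h := fderiv_pullback_antisymm (hαs.differentiableAt (by simp)) hψs
    (dchart x x u) (dchart x x v)
  have hfd : ∀ w : TangentSpace (𝓡 m) x, fderiv ℝ ψ (extChartAt (𝓡 m) x x) (dchart x x w)
      = dchart p x w := fun w => fderiv_chart hxx (mdifferentiableAt_chart hx) w
  rw [hfd, hfd, ← hev.fderiv_eq, hψx] at h
  exact h

/-- The bracket on a manifold is that of the fields pulled back by the inverse chart; near the point
these are the `chartField`s. -/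
theorem mlieBracket_eq_zero {X Y : Π x : M, TangentSpace (𝓡 m) x} {x : M}
    (h : VectorField.lieBracket ℝ (chartField X x) (chartField Y x) (extChartAt (𝓡 m) x x) = 0) :
    VectorField.mlieBracket (𝓡 m) X Y x = 0 := by
  have hxx := mem_extChartAt_source (I := 𝓡 m) x
  have key : ∀ Z : Π x : M, TangentSpace (𝓡 m) x,
      VectorField.mpullbackWithin 𝓘(ℝ, EuclideanSpace ℝ (Fin m)) (𝓡 m) (extChartAt (𝓡 m) x).symm Z
        (range (𝓡 m)) =ᶠ[𝓝 (extChartAt (𝓡 m) x x)] chartField Z x := by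
    intro Z
    filter_upwards [(isOpen_extChartAt_target x).mem_nhds
      ((extChartAt (𝓡 m) x).map_source hxx)] with e he
    have h1 := mfderiv_extChartAt_comp_mfderivWithin_extChartAt_symm he
    have h2 := mfderivWithin_extChartAt_symm_comp_mfderiv_extChartAt he
    rw [VectorField.mpullbackWithin_apply, ContinuousLinearMap.inverse_eq h2 h1]
    rfl
  have hs : (extChartAt (𝓡 m) x).symm ⁻¹' univ ∩ range (𝓡 m) = univ := by simp
  have k : VectorField.lieBracketWithin ℝ
      (VectorField.mpullbackWithin 𝓘(ℝ, EuclideanSpace ℝ (Fin m)) (𝓡 m) (extChartAt (𝓡 m) x).symm X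
        (range (𝓡 m)) : EuclideanSpace ℝ (Fin m) → EuclideanSpace ℝ (Fin m))
      (VectorField.mpullbackWithin 𝓘(ℝ, EuclideanSpace ℝ (Fin m)) (𝓡 m) (extChartAt (𝓡 m) x).symm Y
        (range (𝓡 m)) : EuclideanSpace ℝ (Fin m) → EuclideanSpace ℝ (Fin m))
      ((extChartAt (𝓡 m) x).symm ⁻¹' univ ∩ range (𝓡 m)) (extChartAt (𝓡 m) x x) = 0 := by
    refine (congrArg (fun S => VectorField.lieBracketWithin ℝ _ _ S _) hs).trans ?_
    refine (congrFun VectorField.lieBracketWithin_univ _).trans ?_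
    exact (Filter.EventuallyEq.lieBracket_vectorField_eq (key X) (key Y)).trans h
  rw [VectorField.mlieBracket, VectorField.mlieBracketWithin_apply]
  exact (congrArg (dchart x x).inverse k).trans (map_zero _)

end Charts

/-! ### The splitting by `(dπ, α)` and horizontal lifts. -/

section Quotient

open Filter Topology

/-- A map of manifolds read in the preferred charts at `p` and `q`. -/
def chartMap {m k : ℕ} {M N : Type*} [TopologicalSpace M]
    [ChartedSpace (EuclideanSpace ℝ (Fin m)) M] [TopologicalSpace N]
    [ChartedSpace (EuclideanSpace ℝ (Fin k)) N] (f : M → N) (p : M) (q : N) :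
    EuclideanSpace ℝ (Fin m) → EuclideanSpace ℝ (Fin k) :=
  fun e => extChartAt (𝓡 k) q (f ((extChartAt (𝓡 m) p).symm e))

section ChartMap

variable {m k : ℕ} {M N : Type*} [TopologicalSpace M]
  [ChartedSpace (EuclideanSpace ℝ (Fin m)) M] [IsManifold (𝓡 m) ∞ M] [TopologicalSpace N]
  [ChartedSpace (EuclideanSpace ℝ (Fin k)) N] [IsManifold (𝓡 k) ∞ N] {f : M → N} {p x : M} {q : N}

theorem chartMap_apply (hx : x ∈ (extChartAt (𝓡 m) p).source) :
    chartMap f p q (extChartAt (𝓡 m) p x) = extChartAt (𝓡 k) q (f x) := by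
  rw [chartMap, (extChartAt (𝓡 m) p).left_inv hx]

theorem contDiffAt_chartMap (hx : x ∈ (extChartAt (𝓡 m) p).source)
    (hf : ContMDiffAt (𝓡 m) (𝓡 k) ∞ f x) (hfx : f x ∈ (extChartAt (𝓡 k) q).source) :
    ContDiffAt ℝ ∞ (chartMap (m := m) (k := k) f p q) (extChartAt (𝓡 m) p x) :=
  (contMDiffAt_iff_chart (f := fun y => extChartAt (𝓡 k) q (f y)) hx).1
    ((contMDiffAt_chart hfx).comp x hf)

theorem fderiv_chartMap (hx : x ∈ (extChartAt (𝓡 m) p).source)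
    (hf : MDifferentiableAt (𝓡 m) (𝓡 k) f x) (hfx : f x ∈ (extChartAt (𝓡 k) q).source)
    (u : TangentSpace (𝓡 m) x) :
    fderiv ℝ (chartMap (m := m) (k := k) f p q) (extChartAt (𝓡 m) p x) (dchart p x u)
      = dchart q (f x) (mfderiv (𝓡 m) (𝓡 k) f x u) := by
  have h1 := fderiv_chart (f := fun y => extChartAt (𝓡 k) q (f y)) hx
    ((mdifferentiableAt_chart hfx).comp x hf) u
  have h2 := DFunLike.congr_fun (mfderiv_comp x (mdifferentiableAt_chart hfx) hf) u
  exact h1.trans h2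

end ChartMap

variable {n : ℕ} {M : Type*} [TopologicalSpace M]
  [ChartedSpace (EuclideanSpace ℝ (Fin (2 * n + 1))) M] [IsManifold (𝓡 (2 * n + 1)) ∞ M]
  {N : Type*} [TopologicalSpace N] [ChartedSpace (EuclideanSpace ℝ (Fin (2 * n))) N]
  [IsManifold (𝓡 (2 * n)) ∞ N]
  {S : ContactStructure n M} {U : Set M} {α : Π x : M, TangentSpace (𝓡 (2 * n + 1)) x →L[ℝ] ℝ}
  {X₀ : Π x : M, TangentSpace (𝓡 (2 * n + 1)) x} {π : M → N}

namespace IsSymmetricQuotient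

theorem contMDiffAt (H : IsSymmetricQuotient S U α X₀ π) {x : M} (hx : x ∈ U) :
    ContMDiffAt (𝓡 (2 * n + 1)) (𝓡 (2 * n)) ∞ π x :=
  H.quotient.smooth.contMDiffAt (H.quotient.isOpen.mem_nhds hx)

theorem mdifferentiableAt (H : IsSymmetricQuotient S U α X₀ π) {x : M} (hx : x ∈ U) :
    MDifferentiableAt (𝓡 (2 * n + 1)) (𝓡 (2 * n)) π x :=
  (H.contMDiffAt hx).mdifferentiableAt (by simp)

theorem mem_D_iff (H : IsSymmetricQuotient S U α X₀ π) {x : M} (hx : x ∈ U)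
    {u : TangentSpace (𝓡 (2 * n + 1)) x} : u ∈ S.D x ↔ α x u = 0 :=
  H.normalized.contact.ker x hx u

theorem smooth_form (H : IsSymmetricQuotient S U α X₀ π) : SmoothOneFormOn α U :=
  H.normalized.contact.smooth

/-- A short integral curve of `X₀` through `x` is a trajectory in `U`, so `π` is constant along it;
differentiate at time `0`. -/
theorem mfderiv_reeb (H : IsSymmetricQuotient S U α X₀ π) [T2Space M] {x : M} (hx : x ∈ U) :
    mfderiv (𝓡 (2 * n + 1)) (𝓡 (2 * n)) π x (X₀ x) = 0 := by
  have := isManifold_one (2 * n + 1) M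
  have hs : ContMDiffAt (𝓡 (2 * n + 1)) ((𝓡 (2 * n + 1)).prod
      𝓘(ℝ, EuclideanSpace ℝ (Fin (2 * n + 1)))) 1
      (fun y => (⟨y, X₀ y⟩ : TangentBundle (𝓡 (2 * n + 1)) M)) x :=
    (H.reeb.smooth.contMDiffAt (H.quotient.isOpen.mem_nhds hx)).of_le
      (WithTop.coe_le_coe.2 (le_top : (1 : ℕ∞) ≤ ⊤))
  obtain ⟨γ, h0, hγ⟩ := exists_isMIntegralCurveAt_of_contMDiffAt_boundaryless (t₀ := 0) hs
  have hc : ContinuousAt γ 0 := hγ.continuousAt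
  have hU : ∀ᶠ t in 𝓝 (0 : ℝ), γ t ∈ U :=
    hc.eventually (H.quotient.isOpen.mem_nhds (by rwa [h0]))
  obtain ⟨ε, hε, hb⟩ := Metric.eventually_nhds_iff_ball.1 (hγ.and hU)
  have hconst : ∀ᶠ t in 𝓝 (0 : ℝ), π (γ t) = π x := by
    filter_upwards [Metric.ball_mem_nhds (0 : ℝ) hε] with t ht
    -- `SameTrajectory` needs the whole time interval between `0` and `t` to be mapped into `U`.
    have hsub : uIcc 0 t ⊆ Metric.ball (0 : ℝ) ε := by
      rw [← segment_eq_uIcc]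
      exact (convex_ball (0 : ℝ) ε).segment_subset (Metric.mem_ball_self hε) ht
    refine ((H.quotient.fibre x hx _ (hb t ht).2).2 ⟨γ, 0, t, ?_, ?_, h0, rfl⟩).symm
    · exact fun s hs => (hb s (hsub hs)).1.hasMFDerivWithinAt
    · exact fun s hs => (hb s (hsub hs)).2
  have hd := hγ.self_of_nhds
  have hπ := (H.mdifferentiableAt hx).hasMFDerivAt
  rw [← h0] at hπ
  have h1 := (hπ.comp 0 hd).mfderiv
  have h2 : (π ∘ γ) =ᶠ[𝓝 0] fun _ => π x := hconst
  rw [h2.mfderiv_eq, mfderiv_const] at h1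
  have h3 := DFunLike.congr_fun h1 (1 : ℝ)
  have h4 : mfderiv (𝓡 (2 * n + 1)) (𝓡 (2 * n)) π (γ 0) ((1 : ℝ) • X₀ (γ 0)) = 0 := h3.symm
  rw [one_smul, h0] at h4
  exact h4

/-- The map `(dπ, α)` on the tangent space at `x`, with `dπ` read in the chart at `q`. -/
def splitting (α : Π x : M, TangentSpace (𝓡 (2 * n + 1)) x →L[ℝ] ℝ) (π : M → N) (q : N) (x : M) :
    TangentSpace (𝓡 (2 * n + 1)) x →L[ℝ] EuclideanSpace ℝ (Fin (2 * n)) × ℝ :=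
  ((dchart q (π x)).comp (mfderiv (𝓡 (2 * n + 1)) (𝓡 (2 * n)) π x)).prod (α x)

/-- Both sides have dimension `2n + 1`, so surjectivity suffices: lift by the submersion property,
then correct the value of `α` along `X₀`, which `dπ` kills. -/
theorem isInvertible_splitting (H : IsSymmetricQuotient S U α X₀ π) [T2Space M] {x : M}
    (hx : x ∈ U) {q : N} (hq : π x ∈ (extChartAt (𝓡 (2 * n)) q).source) :
    (splitting α π q x).IsInvertible := by
  have hsurj : Function.Surjective (splitting α π q x) := by
    rintro ⟨w, t⟩
    obtain ⟨w', rfl⟩ := (isInvertible_dchart hq).bijective.surjective w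
    obtain ⟨u, rfl⟩ := H.quotient.submersion x hx w'
    refine ⟨u + (t - α x u) • X₀ x, Prod.ext ?_ ?_⟩
    · change dchart q (π x) (mfderiv _ _ π x _) = dchart q (π x) (mfderiv _ _ π x _)
      rw [map_add, map_smul, H.mfderiv_reeb hx]
      simp
    · change α x _ = t
      rw [map_add, map_smul, H.reeb.one x hx]
      simp
  let A : EuclideanSpace ℝ (Fin (2 * n + 1)) →L[ℝ] EuclideanSpace ℝ (Fin (2 * n)) × ℝ :=
    splitting α π q x
  have hinj : Function.Injective A.toLinearMap :=
    (LinearMap.injective_iff_surjective_of_finrank_eq_finrank (by simp)).2 hsurj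
  exact ⟨(LinearEquiv.ofBijective A.toLinearMap ⟨hinj, hsurj⟩).toContinuousLinearEquiv, rfl⟩

theorem eq_zero_of_horizontal (H : IsSymmetricQuotient S U α X₀ π) [T2Space M] {x : M}
    (hx : x ∈ U) {u : TangentSpace (𝓡 (2 * n + 1)) x}
    (h1 : mfderiv (𝓡 (2 * n + 1)) (𝓡 (2 * n)) π x u = 0) (h2 : α x u = 0) : u = 0 := by
  apply (H.isInvertible_splitting hx (mem_extChartAt_source (π x))).bijective.injective
  rw [map_zero]
  refine Prod.ext ?_ h2
  change dchart _ _ (mfderiv _ _ π x u) = 0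
  rw [h1, map_zero]

/-- The horizontal lift of the vector field which has the constant value `w` in the chart
at `q`. -/
def hlift (α : Π x : M, TangentSpace (𝓡 (2 * n + 1)) x →L[ℝ] ℝ) (π : M → N) (q : N)
    (w : EuclideanSpace ℝ (Fin (2 * n))) (x : M) : TangentSpace (𝓡 (2 * n + 1)) x :=
  (splitting α π q x).inverse (w, 0)

theorem splitting_hlift (H : IsSymmetricQuotient S U α X₀ π) [T2Space M] {x : M}
    (hx : x ∈ U) {q : N} (hq : π x ∈ (extChartAt (𝓡 (2 * n)) q).source)
    (w : EuclideanSpace ℝ (Fin (2 * n))) : splitting α π q x (hlift α π q w x) = (w, 0) := by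
  obtain ⟨e, he⟩ := H.isInvertible_splitting hx hq
  rw [hlift, ← he, ContinuousLinearMap.inverse_equiv]
  exact e.apply_symm_apply _

theorem dchart_mfderiv_hlift (H : IsSymmetricQuotient S U α X₀ π) [T2Space M] {x : M}
    (hx : x ∈ U) {q : N} (hq : π x ∈ (extChartAt (𝓡 (2 * n)) q).source)
    (w : EuclideanSpace ℝ (Fin (2 * n))) :
    dchart q (π x) (mfderiv (𝓡 (2 * n + 1)) (𝓡 (2 * n)) π x (hlift α π q w x)) = w :=
  congrArg Prod.fst (H.splitting_hlift hx hq w)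

theorem form_hlift (H : IsSymmetricQuotient S U α X₀ π) [T2Space M] {x : M}
    (hx : x ∈ U) {q : N} (hq : π x ∈ (extChartAt (𝓡 (2 * n)) q).source)
    (w : EuclideanSpace ℝ (Fin (2 * n))) : α x (hlift α π q w x) = 0 :=
  congrArg Prod.snd (H.splitting_hlift hx hq w)

theorem hlift_dchart_mfderiv (H : IsSymmetricQuotient S U α X₀ π) [T2Space M] {x : M}
    (hx : x ∈ U) {q : N} (hq : π x ∈ (extChartAt (𝓡 (2 * n)) q).source)
    {u : TangentSpace (𝓡 (2 * n + 1)) x} (hu : u ∈ S.D x) :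
    hlift α π q (dchart q (π x) (mfderiv (𝓡 (2 * n + 1)) (𝓡 (2 * n)) π x u)) x = u := by
  apply (H.isInvertible_splitting hx hq).bijective.injective
  rw [H.splitting_hlift hx hq]
  exact Prod.ext rfl ((H.mem_D_iff hx).1 hu).symm

/-- The map `(dπ, α)` in the chart at `p`. -/
theorem isInvertible_chart_splitting (H : IsSymmetricQuotient S U α X₀ π) [T2Space M] {x p : M}
    (hx : x ∈ U) (hp : x ∈ (extChartAt (𝓡 (2 * n + 1)) p).source)
    {q : N} (hq : π x ∈ (extChartAt (𝓡 (2 * n)) q).source) :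
    ((fderiv ℝ (chartMap (m := 2 * n + 1) (k := 2 * n) π p q) (extChartAt (𝓡 (2 * n + 1)) p x)).prod
      (chartForm α p (extChartAt (𝓡 (2 * n + 1)) p x))).IsInvertible := by
  obtain ⟨e, he⟩ := isInvertible_dchart hp
  obtain ⟨f, hf⟩ := H.isInvertible_splitting hx hq
  refine ⟨e.symm.trans f, ContinuousLinearMap.ext fun w => ?_⟩
  obtain ⟨u, rfl⟩ := e.surjective w
  have h1 : e u = dchart p x u := DFunLike.congr_fun he u
  have h2 : f u = splitting α π q x u := DFunLike.congr_fun hf u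
  have h3 := fderiv_chartMap hp (H.mdifferentiableAt hx) hq u
  have h4 := chartForm_dchart α hp u
  have h5 : (e.symm.trans f) (e u) = f u := by simp
  refine h5.trans (h2.trans ?_)
  rw [h1]
  exact Prod.ext h3.symm h4.symm

theorem isOpen_domain (H : IsSymmetricQuotient S U α X₀ π) (q : N) :
    IsOpen (U ∩ π ⁻¹' (extChartAt (𝓡 (2 * n)) q).source) :=
  H.quotient.smooth.continuousOn.isOpen_inter_preimage H.quotient.isOpen
    (isOpen_extChartAt_source q)

/-- In charts the lift is the inverse of a smooth family of invertible maps applied to the fixed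
vector `(w, 0)`, and inversion of continuous linear maps is smooth. -/
theorem isSectionOn_hlift (H : IsSymmetricQuotient S U α X₀ π) [T2Space M] (q : N)
    (w : EuclideanSpace ℝ (Fin (2 * n))) :
    IsSectionOn S.D (hlift α π q w) (U ∩ π ⁻¹' (extChartAt (𝓡 (2 * n)) q).source) := by
  refine ⟨smoothFieldOn_of_contDiffAt fun x hx => ?_,
    fun x hx => (H.mem_D_iff hx.1).2 (H.form_hlift hx.1 hx.2 w)⟩
  have hxx := mem_extChartAt_source (I := 𝓡 (2 * n + 1)) x
  set A : EuclideanSpace ℝ (Fin (2 * n + 1)) → EuclideanSpace ℝ (Fin (2 * n + 1)) →L[ℝ]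
    EuclideanSpace ℝ (Fin (2 * n)) × ℝ :=
      fun e => (fderiv ℝ (chartMap (k := 2 * n) π x q) e).prod (chartForm α x e) with hA
  have hinv := H.isInvertible_chart_splitting hx.1 hxx hx.2
  have hAs : ContDiffAt ℝ ∞ A (extChartAt (𝓡 (2 * n + 1)) x x) :=
    contDiffAt_clm_prod
      ((contDiffAt_chartMap hxx (H.contMDiffAt hx.1) hx.2).fderiv_right (m := ∞) (by simp))
      (smoothOneFormOn_contDiffAt H.quotient.isOpen H.smooth_form hxx hx.1)
  have hsm : ContDiffAt ℝ ∞ (fun e => (A e).inverse (w, (0 : ℝ)))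
      (extChartAt (𝓡 (2 * n + 1)) x x) := by
    obtain ⟨e, he⟩ := hinv
    have h1 : ContDiffAt ℝ ∞ ContinuousLinearMap.inverse (A (extChartAt (𝓡 (2 * n + 1)) x x)) := by
      simp only [hA, ← he]
      exact contDiffAt_map_inverse e
    exact (h1.comp _ hAs).clm_apply contDiffAt_const
  refine hsm.congr_of_eventuallyEq ?_
  have hev : ∀ᶠ e in 𝓝 (extChartAt (𝓡 (2 * n + 1)) x x),
      (extChartAt (𝓡 (2 * n + 1)) x).symm e ∈ U ∩ π ⁻¹' (extChartAt (𝓡 (2 * n)) q).source := by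
    refine (continuousAt_extChartAt_symm x).eventually ((H.isOpen_domain q).mem_nhds ?_)
    rwa [(extChartAt (𝓡 (2 * n + 1)) x).left_inv hxx]
  filter_upwards [hev, (isOpen_extChartAt_target x).mem_nhds
    ((extChartAt (𝓡 (2 * n + 1)) x).map_source hxx)] with e he het
  have hy := (extChartAt (𝓡 (2 * n + 1)) x).map_target het
  have hinv' := H.isInvertible_chart_splitting he.1 hy he.2
  have h3 := fderiv_chartMap hy (H.mdifferentiableAt he.1) he.2
    (hlift α π q w ((extChartAt (𝓡 (2 * n + 1)) x).symm e))
  have h4 := chartForm_dchart α hy (hlift α π q w ((extChartAt (𝓡 (2 * n + 1)) x).symm e))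
  rw [H.dchart_mfderiv_hlift he.1 he.2] at h3
  rw [H.form_hlift he.1 he.2] at h4
  rw [(extChartAt (𝓡 (2 * n + 1)) x).right_inv het] at h3 h4 hinv'
  have h5 : A e (chartField (hlift α π q w) x e) = (w, 0) := Prod.ext h3 h4
  rw [← h5]
  obtain ⟨f, hf⟩ := hinv'
  have hAe : A e = f := hf.symm
  rw [hAe, ContinuousLinearMap.inverse_equiv]
  exact (f.symm_apply_apply _).symm

/-- The pivot of the descent argument: because these brackets vanish, the Lie derivative of a tensor
evaluated on two lifts is just the derivative of a function along `X₀`. -/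
theorem mlieBracket_reeb_hlift (H : IsSymmetricQuotient S U α X₀ π) [T2Space M] {q : N}
    (w : EuclideanSpace ℝ (Fin (2 * n))) {x : M} (hx : x ∈ U)
    (hq : π x ∈ (extChartAt (𝓡 (2 * n)) q).source) :
    VectorField.mlieBracket (𝓡 (2 * n + 1)) X₀ (hlift α π q w) x = 0 := by
  have hxx := mem_extChartAt_source (I := 𝓡 (2 * n + 1)) x
  have hev : ∀ᶠ e in 𝓝 (extChartAt (𝓡 (2 * n + 1)) x x),
      (extChartAt (𝓡 (2 * n + 1)) x).symm e ∈ U ∩ π ⁻¹' (extChartAt (𝓡 (2 * n)) q).source := by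
    refine (continuousAt_extChartAt_symm x).eventually ((H.isOpen_domain q).mem_nhds ?_)
    rw [(extChartAt (𝓡 (2 * n + 1)) x).left_inv hxx]
    exact ⟨hx, hq⟩
  have hev' := hev.and ((isOpen_extChartAt_target x).mem_nhds
    ((extChartAt (𝓡 (2 * n + 1)) x).map_source hxx))
  have hr : ∀ {e}, e ∈ (extChartAt (𝓡 (2 * n + 1)) x).target →
      extChartAt (𝓡 (2 * n + 1)) x ((extChartAt (𝓡 (2 * n + 1)) x).symm e) = e :=
    fun he => (extChartAt (𝓡 (2 * n + 1)) x).right_inv he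
  apply mlieBracket_eq_zero
  refine lieBracket_eq_zero (a := chartForm α x) (P := chartMap (k := 2 * n) π x q) (c := 1) (w := w)
    ((smoothOneFormOn_contDiffAt H.quotient.isOpen H.smooth_form hxx hx).differentiableAt (by simp))
    (contDiffAt_chartMap hxx (H.contMDiffAt hx) hq)
    ((smoothFieldOn_contDiffAt H.quotient.isOpen H.reeb.smooth hxx hx).differentiableAt (by simp))
    ((smoothFieldOn_contDiffAt (H.isOpen_domain q) (H.isSectionOn_hlift q w).smooth hxx
      ⟨hx, hq⟩).differentiableAt (by simp)) ?_ ?_ ?_ ?_ ?_ ?_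
  · filter_upwards [hev'] with e he
    have h := chartForm_dchart α ((extChartAt (𝓡 (2 * n + 1)) x).map_target he.2) (X₀ _)
    rw [hr he.2, H.reeb.one _ he.1.1] at h
    exact h
  · filter_upwards [hev'] with e he
    have h := chartForm_dchart α ((extChartAt (𝓡 (2 * n + 1)) x).map_target he.2)
      (hlift α π q w _)
    rw [hr he.2, H.form_hlift he.1.1 he.1.2] at h
    exact h
  · filter_upwards [hev'] with e he
    have h := fderiv_chartMap ((extChartAt (𝓡 (2 * n + 1)) x).map_target he.2)
      (H.mdifferentiableAt he.1.1) he.1.2 (X₀ _)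
    rw [hr he.2, H.mfderiv_reeb he.1.1, map_zero] at h
    exact h
  · filter_upwards [hev'] with e he
    have h := fderiv_chartMap ((extChartAt (𝓡 (2 * n + 1)) x).map_target he.2)
      (H.mdifferentiableAt he.1.1) he.1.2 (hlift α π q w _)
    rw [hr he.2, H.dchart_mfderiv_hlift he.1.1 he.1.2] at h
    exact h
  · intro u
    obtain ⟨u, rfl⟩ := (isInvertible_dchart hxx).bijective.surjective u
    rw [chartField_apply X₀ hxx]
    exact H.reeb.ker x hx u
  · intro u h1 h2
    apply (H.isInvertible_chart_splitting hx hxx hq).bijective.injective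
    rw [map_zero]
    exact Prod.ext h1 h2

end IsSymmetricQuotient

end Quotient

/-! ### Descent of invariant tensors on `D` to the quotient. -/

section Projection

open Filter Topology

-- In finite dimension a family of bilinear maps is smooth once its values on fixed vectors are.
-- Hence `C` need only be smooth for each pair `w`, `w'`, and its bilinearity need not be supplied.
set_option synthInstance.maxHeartbeats 400000 in
theorem smoothBilin_of_coordinates {m : ℕ} {M : Type*} [TopologicalSpace M]
    [ChartedSpace (EuclideanSpace ℝ (Fin m)) M] [IsManifold (𝓡 m) ∞ M]
    {B : Π x : M, TangentSpace (𝓡 m) x →L[ℝ] TangentSpace (𝓡 m) x →L[ℝ] ℝ}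
    (h : ∀ p : M, ∃ O : Set M, IsOpen O ∧ p ∈ O ∧ O ⊆ (extChartAt (𝓡 m) p).source ∧
      ∃ C : M → EuclideanSpace ℝ (Fin m) → EuclideanSpace ℝ (Fin m) → ℝ,
        (∀ w w', ContMDiffOn (𝓡 m) 𝓘(ℝ, ℝ) ∞ (fun y => C y w w') O) ∧
        ∀ y ∈ O, ∀ u v, B y u v = C y (dchart p y u) (dchart p y v)) : SmoothBilin B := by
  have := isManifold_one m M
  intro p
  obtain ⟨O, hO, hpO, hOs, C, hC, hBC⟩ := h p
  have hpp := mem_extChartAt_source (I := 𝓡 m) p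
  rw [(trivializationAt (EuclideanSpace ℝ (Fin m) →L[ℝ] EuclideanSpace ℝ (Fin m) →L[ℝ] ℝ)
    (fun x : M => TangentSpace (𝓡 m) x →L[ℝ] TangentSpace (𝓡 m) x →L[ℝ] ℝ)
    p).contMDiffAt_section_iff (by simp), contMDiffAt_iff_chart hpp]
  have hO' : IsOpen ((extChartAt (𝓡 m) p).target ∩ (extChartAt (𝓡 m) p).symm ⁻¹' O) :=
    (continuousOn_extChartAt_symm p).isOpen_inter_preimage (isOpen_extChartAt_target p) hO
  refine ContDiffOn.contDiffAt ?_ (hO'.mem_nhds ⟨(extChartAt (𝓡 m) p).map_source hpp,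
    by rwa [mem_preimage, (extChartAt (𝓡 m) p).left_inv hpp]⟩)
  refine contDiffOn_clm_apply.2 fun w => contDiffOn_clm_apply.2 fun w' => ?_
  have hs : ContDiffOn ℝ ∞ (fun e => C ((extChartAt (𝓡 m) p).symm e) w w')
      ((extChartAt (𝓡 m) p).target ∩ (extChartAt (𝓡 m) p).symm ⁻¹' O) := by
    intro e he
    have h1 := (contMDiffAt_iff_chart ((extChartAt (𝓡 m) p).map_target he.1)).1
      ((hC w w').contMDiffAt (hO.mem_nhds he.2))
    rw [(extChartAt (𝓡 m) p).right_inv he.1] at h1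
    exact h1.contDiffWithinAt
  refine hs.congr fun e he => ?_
  have hy : (extChartAt (𝓡 m) p).symm e ∈ (chartAt (EuclideanSpace ℝ (Fin m)) p).source := by
    simpa using (extChartAt (𝓡 m) p).map_target he.1
  have hbase : (extChartAt (𝓡 m) p).symm e ∈
    (trivializationAt (EuclideanSpace ℝ (Fin m)) (TangentSpace (𝓡 m)) p).baseSet := by
    simpa using hy
  rw [hom_trivializationAt_apply]
  have key : ∀ t : ℝ, (trivializationAt ℝ (Bundle.Trivial M ℝ) p).linearMapAt ℝ
      ((extChartAt (𝓡 m) p).symm e) t = t := fun t => by simp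
  have hd : ∀ w, dchart p ((extChartAt (𝓡 m) p).symm e)
      ((trivializationAt (EuclideanSpace ℝ (Fin m)) (TangentSpace (𝓡 m)) p).symm
        ((extChartAt (𝓡 m) p).symm e) w) = w := fun w => by
    rw [dchart, ← TangentBundle.continuousLinearMapAt_trivializationAt hy,
      ← Bundle.Trivialization.symmL_apply (R := ℝ) _ hbase]
    exact Bundle.Trivialization.continuousLinearMapAt_symmL (R := ℝ)
      (trivializationAt (EuclideanSpace ℝ (Fin m)) (TangentSpace (𝓡 m)) p) hbase w
  have h2 := inCoordinates_apply_eq₂ (𝕜 := ℝ) (E₃ := Bundle.Trivial M ℝ) (F₃ := ℝ)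
    (ϕ := B ((extChartAt (𝓡 m) p).symm e)) (v := w) (w := w') hbase hbase (mem_univ _)
  refine h2.trans ((key _).trans ?_)
  rw [hBC _ he.2, hd, hd]

variable {n : ℕ} {M : Type*} [TopologicalSpace M]
  [ChartedSpace (EuclideanSpace ℝ (Fin (2 * n + 1))) M] [IsManifold (𝓡 (2 * n + 1)) ∞ M]
  {N : Type*} [TopologicalSpace N] [ChartedSpace (EuclideanSpace ℝ (Fin (2 * n))) N]
  [IsManifold (𝓡 (2 * n)) ∞ N]
  {S : ContactStructure n M} {U : Set M} {α : Π x : M, TangentSpace (𝓡 (2 * n + 1)) x →L[ℝ] ℝ}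
  {X₀ : Π x : M, TangentSpace (𝓡 (2 * n + 1)) x} {π : M → N}

namespace IsSymmetricQuotient

theorem eventually_mem_domain (H : IsSymmetricQuotient S U α X₀ π) {p : M} (hp : p ∈ U) {q : N}
    (hq : π p ∈ (extChartAt (𝓡 (2 * n)) q).source) :
    ∀ᶠ e in 𝓝 (extChartAt (𝓡 (2 * n + 1)) p p), e ∈ (extChartAt (𝓡 (2 * n + 1)) p).target ∧
      (extChartAt (𝓡 (2 * n + 1)) p).symm e ∈ U ∩ π ⁻¹' (extChartAt (𝓡 (2 * n)) q).source := by
  have hpp := mem_extChartAt_source (I := 𝓡 (2 * n + 1)) p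
  have htar : ∀ᶠ e in 𝓝 (extChartAt (𝓡 (2 * n + 1)) p p),
      e ∈ (extChartAt (𝓡 (2 * n + 1)) p).target :=
    (isOpen_extChartAt_target p).mem_nhds ((extChartAt (𝓡 (2 * n + 1)) p).map_source hpp)
  refine htar.and ?_
  refine (continuousAt_extChartAt_symm p).eventually ((H.isOpen_domain q).mem_nhds ?_)
  rw [(extChartAt (𝓡 (2 * n + 1)) p).left_inv hpp]
  exact ⟨hp, hq⟩

theorem eventually_contDiffAt_chartMap (H : IsSymmetricQuotient S U α X₀ π) {p : M} (hp : p ∈ U)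
    {q : N} (hq : π p ∈ (extChartAt (𝓡 (2 * n)) q).source) :
    ∀ᶠ e in 𝓝 (extChartAt (𝓡 (2 * n + 1)) p p),
      ContDiffAt ℝ ∞ (chartMap (m := 2 * n + 1) (k := 2 * n) π p q) e := by
  filter_upwards [H.eventually_mem_domain hp hq] with e he
  have h := contDiffAt_chartMap (q := q) ((extChartAt (𝓡 (2 * n + 1)) p).map_target he.1)
    (H.contMDiffAt he.2.1) he.2.2
  rwa [(extChartAt (𝓡 (2 * n + 1)) p).right_inv he.1] at h

/-- Complete `π` in charts by the value of the contact form at `p`, frozen as a linear function, to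
a local diffeomorphism; the section is its inverse with the last coordinate held at the value it has
at `p`. -/
theorem exists_local_section (H : IsSymmetricQuotient S U α X₀ π) [T2Space M] {p : M}
    (hp : p ∈ U) : ∃ σ : N → M, ∀ᶠ y in 𝓝 (π p), σ y ∈ U ∧ π (σ y) = y ∧
      ContMDiffAt (𝓡 (2 * n)) (𝓡 (2 * n + 1)) ∞ σ y := by
  set q := π p with hq
  have hqq := mem_extChartAt_source (I := 𝓡 (2 * n)) q
  have hpp := mem_extChartAt_source (I := 𝓡 (2 * n + 1)) p
  set P := chartMap (m := 2 * n + 1) (k := 2 * n) π p q with hP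
  set p' := extChartAt (𝓡 (2 * n + 1)) p p with hp'
  set a := chartForm α p p' with ha
  have hPs := H.eventually_contDiffAt_chartMap hp hqq
  have hPd : HasFDerivAt P (fderiv ℝ P p') p' :=
    (hPs.self_of_nhds.differentiableAt (by simp)).hasFDerivAt
  obtain ⟨Φ, hΦs, hΦ, -, hΦi⟩ := exists_smooth_inverse (f := fun z => (P z, a z)) (x := p')
    (by filter_upwards [hPs] with z hz using hz.prodMk a.contDiff.contDiffAt)
    (by
      rw [(hPd.prodMk a.hasFDerivAt).fderiv]
      exact H.isInvertible_chart_splitting hp hpp hqq)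
  set s : EuclideanSpace ℝ (Fin (2 * n)) → EuclideanSpace ℝ (Fin (2 * n + 1)) :=
    fun z => Φ.symm (z, a p') with hs
  set z₀ := extChartAt (𝓡 (2 * n)) q q with hz₀
  have hPp : P p' = z₀ := chartMap_apply hpp
  have hΦp : Φ p' = (z₀, a p') := by rw [hΦ, hPp]
  have hs0 : s z₀ = p' := by
    change Φ.symm (z₀, a p') = p'
    rw [← hΦp, Φ.left_inv hΦs]
  have htar : ∀ᶠ z in 𝓝 z₀, (z, a p') ∈ Φ.target := by
    have hc : ContinuousAt (fun z : EuclideanSpace ℝ (Fin (2 * n)) => (z, a p')) z₀ := by fun_prop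
    refine hc.eventually (Φ.open_target.mem_nhds ?_)
    change (z₀, a p') ∈ Φ.target
    rw [← hΦp]; exact Φ.map_source hΦs
  have hss : ∀ᶠ z in 𝓝 z₀, ContDiffAt ℝ ∞ s z := by
    filter_upwards [htar] with z hz
    exact (hΦi _ hz).comp z (contDiffAt_id.prodMk contDiffAt_const)
  have hsP : ∀ᶠ z in 𝓝 z₀, P (s z) = z := by
    filter_upwards [htar] with z hz
    have := Φ.right_inv hz
    rw [hΦ] at this
    exact congrArg Prod.fst this
  have hst : Tendsto s (𝓝 z₀) (𝓝 p') := by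
    have := hss.self_of_nhds.continuousAt.tendsto
    rwa [hs0] at this
  have hsd := hst.eventually (H.eventually_mem_domain hp hqq)
  have hchart : Tendsto (extChartAt (𝓡 (2 * n)) q) (𝓝 q) (𝓝 z₀) := continuousAt_extChartAt q
  refine ⟨fun y => (extChartAt (𝓡 (2 * n + 1)) p).symm (s (extChartAt (𝓡 (2 * n)) q y)), ?_⟩
  filter_upwards [hchart.eventually hss, hchart.eventually hsP, hchart.eventually hsd,
    (isOpen_extChartAt_source q).mem_nhds hqq] with y h1 h2 h3 h4
  refine ⟨h3.2.1, ?_, ?_⟩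
  · exact (extChartAt (𝓡 (2 * n)) q).injOn h3.2.2 h4 h2
  · exact (contMDiffAt_chart_symm h3.1).comp y
      ((contMDiffAt_iff_contDiffAt.2 h1).comp y (contMDiffAt_chart h4))

section Tensor

variable {b : Π x : M, TangentSpace (𝓡 (2 * n + 1)) x → TangentSpace (𝓡 (2 * n + 1)) x → ℝ}

/-- Invariance under `X₀` makes `b` on two lifts constant along trajectories, and two points of one
fibre are joined by a trajectory. Here `b` stands for the metric or for `ω`. -/
theorem apply_hlift_eq (H : IsSymmetricQuotient S U α X₀ π) [T2Space M]
    (hs : ∀ V X Y, IsOpen V → V ⊆ U → IsSectionOn S.D X V → IsSectionOn S.D Y V →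
      ContMDiffOn (𝓡 (2 * n + 1)) 𝓘(ℝ, ℝ) ∞ (fun x => b x (X x) (Y x)) V)
    (hl : ∀ V X Y, IsOpen V → V ⊆ U → IsSectionOn S.D X V → IsSectionOn S.D Y V →
      ∀ x ∈ V, lieDeriv X₀ b X Y x = 0)
    (hb : ∀ x ∈ U, ∃ β : S.D x →ₗ[ℝ] S.D x →ₗ[ℝ] ℝ, ∀ u v : S.D x, b x u v = β u v)
    {q : N} (w w' : EuclideanSpace ℝ (Fin (2 * n))) {x x' : M} (hx : x ∈ U) (hx' : x' ∈ U)
    (hq : π x ∈ (extChartAt (𝓡 (2 * n)) q).source) (hxx : π x = π x') :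
    b x (hlift α π q w x) (hlift α π q w' x) = b x' (hlift α π q w x') (hlift α π q w' x') := by
  set O := U ∩ π ⁻¹' (extChartAt (𝓡 (2 * n)) q).source with hO
  have hOo : IsOpen O := H.isOpen_domain q
  set f : M → ℝ := fun y => b y (hlift α π q w y) (hlift α π q w' y) with hf
  have hfs : ContMDiffOn (𝓡 (2 * n + 1)) 𝓘(ℝ, ℝ) ∞ f O :=
    hs O _ _ hOo inter_subset_left (H.isSectionOn_hlift q w) (H.isSectionOn_hlift q w')
  have hfd : ∀ y ∈ O, mfderiv (𝓡 (2 * n + 1)) 𝓘(ℝ, ℝ) f y (X₀ y) = 0 := by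
    intro y hy
    obtain ⟨β, hβ⟩ := hb y hy.1
    obtain ⟨r, hr⟩ : ∃ r : ℝ, r = mfderiv (𝓡 (2 * n + 1)) 𝓘(ℝ, ℝ) f y (X₀ y) := ⟨_, rfl⟩
    have h1 : r - b y (VectorField.mlieBracket (𝓡 (2 * n + 1)) X₀ (hlift α π q w) y)
        (hlift α π q w' y) - b y (hlift α π q w y)
        (VectorField.mlieBracket (𝓡 (2 * n + 1)) X₀ (hlift α π q w') y) = 0 := by
      subst hr
      exact hl O _ _ hOo inter_subset_left (H.isSectionOn_hlift q w) (H.isSectionOn_hlift q w') y hy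
    -- A priori `b` is only a function of two vectors; its bilinear model `β` on `D` shows that the
    -- terms containing the zero bracket vanish.
    have h2 := hβ 0 ⟨_, (H.isSectionOn_hlift q w').mem y hy⟩
    have h3 := hβ ⟨_, (H.isSectionOn_hlift q w).mem y hy⟩ 0
    simp only [map_zero, LinearMap.zero_apply, ZeroMemClass.coe_zero] at h2 h3
    rw [H.mlieBracket_reeb_hlift w hy.1 hy.2, H.mlieBracket_reeb_hlift w' hy.1 hy.2, h2, h3,
      sub_zero, sub_zero] at h1
    exact hr.symm.trans h1
  obtain ⟨γ, a, c, hγ, hm, rfl, rfl⟩ := (H.quotient.fibre x hx x' hx').1 hxx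
  -- The curve stays in one fibre of `π`, hence over the chart domain where the lifts are defined.
  have hγO : ∀ t ∈ uIcc a c, γ t ∈ O := by
    intro t ht
    refine ⟨hm ht, ?_⟩
    have hsub : uIcc a t ⊆ uIcc a c := uIcc_subset_uIcc_left ht
    have : π (γ a) = π (γ t) := (H.quotient.fibre _ hx _ (hm ht)).2
      ⟨γ, a, t, hγ.mono hsub, fun s hs => hm (hsub hs), rfl, rfl⟩
    rw [mem_preimage, ← this]
    exact hq
  have hder : ∀ t ∈ uIcc a c, HasFDerivWithinAt (f ∘ γ) (0 : ℝ →L[ℝ] ℝ) (uIcc a c) t := by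
    intro t ht
    have h1 := ((hfs.contMDiffAt (hOo.mem_nhds (hγO t ht))).mdifferentiableAt
      (by simp)).hasMFDerivAt
    have h2 := (h1.comp_hasMFDerivWithinAt t (hγ t ht)).hasFDerivWithinAt
    refine h2.congr_fderiv (ContinuousLinearMap.ext fun (s : ℝ) => ?_)
    have h3 := hfd _ (hγO t ht)
    have h4 : mfderiv (𝓡 (2 * n + 1)) 𝓘(ℝ, ℝ) f (γ t) (s • X₀ (γ t)) = 0 := by
      rw [map_smul, h3, smul_zero]
    exact h4
  have h := Convex.norm_image_sub_le_of_norm_hasFDerivWithin_le (C := 0) hder (by simp)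
    (convex_uIcc a c) right_mem_uIcc left_mem_uIcc
  rw [zero_mul] at h
  exact sub_eq_zero.1 (norm_le_zero_iff.1 h)

theorem exists_projection (H : IsSymmetricQuotient S U α X₀ π) [T2Space M]
    (hs : ∀ V X Y, IsOpen V → V ⊆ U → IsSectionOn S.D X V → IsSectionOn S.D Y V →
      ContMDiffOn (𝓡 (2 * n + 1)) 𝓘(ℝ, ℝ) ∞ (fun x => b x (X x) (Y x)) V)
    (hl : ∀ V X Y, IsOpen V → V ⊆ U → IsSectionOn S.D X V → IsSectionOn S.D Y V →
      ∀ x ∈ V, lieDeriv X₀ b X Y x = 0)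
    (hb : ∀ x ∈ U, ∃ β : S.D x →ₗ[ℝ] S.D x →ₗ[ℝ] ℝ, ∀ u v : S.D x, b x u v = β u v) :
    ∃ B : Π y : N, TangentSpace (𝓡 (2 * n)) y →L[ℝ] TangentSpace (𝓡 (2 * n)) y →L[ℝ] ℝ,
      SmoothBilin B ∧ PullsBackOnD S U π B b := by
  -- The form at `y` is `b` on the lifts, taken in the chart at `y`, at one chosen point of the
  -- fibre; `apply_hlift_eq` makes every other point of the fibre give the same value.
  have hpt : ∀ y : N, ∃ B : TangentSpace (𝓡 (2 * n)) y →L[ℝ] TangentSpace (𝓡 (2 * n)) y →L[ℝ] ℝ,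
      ∀ x ∈ U, π x = y → ∀ u v, B u v =
        b x (hlift α π y (dchart y y u) x) (hlift α π y (dchart y y v) x) := by
    intro y
    have hyy := mem_extChartAt_source (I := 𝓡 (2 * n)) y
    obtain ⟨x, hx, hxy⟩ : y ∈ π '' U := by rw [H.quotient.surjective]; trivial
    have hq : π x ∈ (extChartAt (𝓡 (2 * n)) y).source := by rwa [hxy]
    obtain ⟨β, hβ⟩ := hb x hx
    let L : EuclideanSpace ℝ (Fin (2 * n)) →ₗ[ℝ] S.D x :=
      ((splitting α π y x).inverse.toLinearMap.comp
        (LinearMap.inl ℝ (EuclideanSpace ℝ (Fin (2 * n))) ℝ)).codRestrict (S.D x)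
        (fun w => (H.isSectionOn_hlift y w).mem x ⟨hx, hq⟩)
    have hL : ∀ w, (L w : TangentSpace (𝓡 (2 * n + 1)) x) = hlift α π y w x := fun w => rfl
    let B₀ : EuclideanSpace ℝ (Fin (2 * n)) →L[ℝ] EuclideanSpace ℝ (Fin (2 * n)) →L[ℝ] ℝ :=
      (β.compl₁₂ L L).toContinuousBilinearMap
    let d : EuclideanSpace ℝ (Fin (2 * n)) →L[ℝ] EuclideanSpace ℝ (Fin (2 * n)) := dchart y y
    refine ⟨B₀.bilinearComp d d, ?_⟩
    intro x' hx' hxy' u v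
    rw [← H.apply_hlift_eq hs hl hb _ _ hx hx' hq (hxy.trans hxy'.symm), ← hL, ← hL, hβ]
    rfl
  choose B hB using hpt
  have hpull : PullsBackOnD S U π B b := by
    intro x hx u hu v hv
    have hxx := mem_extChartAt_source (I := 𝓡 (2 * n)) (π x)
    rw [hB (π x) x hx rfl, H.hlift_dchart_mfderiv hx hxx hu, H.hlift_dchart_mfderiv hx hxx hv]
  refine ⟨B, smoothBilin_of_coordinates fun q => ?_, hpull⟩
  have hqq := mem_extChartAt_source (I := 𝓡 (2 * n)) q
  obtain ⟨p, hp, rfl⟩ : q ∈ π '' U := by rw [H.quotient.surjective]; trivial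
  obtain ⟨σ, hσ⟩ := H.exists_local_section hp
  obtain ⟨O, hO, hOo, hpO⟩ := eventually_nhds_iff.1
    (hσ.and ((isOpen_extChartAt_source (π p)).mem_nhds hqq))
  -- The coefficients of `B` in the fixed chart at `π p` are the smooth functions `b` of two lifts,
  -- composed with the local section `σ`.
  refine ⟨O, hOo, hpO, fun y hy => (hO y hy).2,
    fun y w w' => b (σ y) (hlift α π (π p) w (σ y)) (hlift α π (π p) w' (σ y)), ?_, ?_⟩
  · intro w w' y hy
    obtain ⟨⟨h1, h2, h3⟩, h4⟩ := hO y hy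
    have hmem : σ y ∈ U ∩ π ⁻¹' (extChartAt (𝓡 (2 * n)) (π p)).source :=
      ⟨h1, by rwa [mem_preimage, h2]⟩
    have h5 := (hs _ _ _ (H.isOpen_domain (π p)) inter_subset_left
      (H.isSectionOn_hlift (π p) w) (H.isSectionOn_hlift (π p) w')).contMDiffAt
      ((H.isOpen_domain (π p)).mem_nhds hmem)
    exact (h5.comp y h3).contMDiffWithinAt
  · intro y hy u v
    obtain ⟨⟨h1, h2, -⟩, h4⟩ := hO y hy
    change B y u v = b (σ y) (hlift α π (π p) (dchart (π p) y u) (σ y))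
      (hlift α π (π p) (dchart (π p) y v) (σ y))
    -- Naming the point lets `y` be replaced by `π x`, so that `u` and `v` become tangent vectors at
    -- `π x` without transport.
    obtain ⟨x, hxσ⟩ : ∃ x, x = σ y := ⟨_, rfl⟩
    rw [← hxσ] at h1 h2 ⊢
    subst h2
    obtain ⟨u', hu', rfl⟩ : ∃ u' ∈ S.D x, mfderiv (𝓡 (2 * n + 1)) (𝓡 (2 * n)) π x u' = u :=
      ⟨_, (H.isSectionOn_hlift (π p) (dchart (π p) (π x) u)).mem x ⟨h1, h4⟩,
        (isInvertible_dchart h4).bijective.injective (H.dchart_mfderiv_hlift h1 h4 _)⟩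
    obtain ⟨v', hv', rfl⟩ : ∃ v' ∈ S.D x, mfderiv (𝓡 (2 * n + 1)) (𝓡 (2 * n)) π x v' = v :=
      ⟨_, (H.isSectionOn_hlift (π p) (dchart (π p) (π x) v)).mem x ⟨h1, h4⟩,
        (isInvertible_dchart h4).bijective.injective (H.dchart_mfderiv_hlift h1 h4 _)⟩
    rw [hpull x h1 u' hu' v' hv', H.hlift_dchart_mfderiv h1 h4 hu',
      H.hlift_dchart_mfderiv h1 h4 hv']

/-- Every vector tangent to the quotient has a horizontal lift. -/
theorem exists_horizontal (H : IsSymmetricQuotient S U α X₀ π) [T2Space M] {x : M} (hx : x ∈ U)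
    (w : TangentSpace (𝓡 (2 * n)) (π x)) :
    ∃ u ∈ S.D x, mfderiv (𝓡 (2 * n + 1)) (𝓡 (2 * n)) π x u = w :=
  have h := mem_extChartAt_source (I := 𝓡 (2 * n)) (π x)
  ⟨_, (H.isSectionOn_hlift (π x) (dchart (π x) (π x) w)).mem x ⟨hx, h⟩,
    (isInvertible_dchart h).bijective.injective (H.dchart_mfderiv_hlift hx h _)⟩

theorem projection_unique (H : IsSymmetricQuotient S U α X₀ π) [T2Space M]
    {B B' : Π y : N, TangentSpace (𝓡 (2 * n)) y →L[ℝ] TangentSpace (𝓡 (2 * n)) y →L[ℝ] ℝ}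
    (hB : PullsBackOnD S U π B b) (hB' : PullsBackOnD S U π B' b) : B = B' := by
  funext y
  obtain ⟨x, hx, rfl⟩ : y ∈ π '' U := by rw [H.quotient.surjective]; trivial
  refine ContinuousLinearMap.ext fun w => ContinuousLinearMap.ext fun w' => ?_
  obtain ⟨u, hu, rfl⟩ := H.exists_horizontal hx w
  obtain ⟨v, hv, rfl⟩ := H.exists_horizontal hx w'
  rw [hB x hx u hu v hv, hB' x hx u hu v hv]

end Tensor

theorem metric_apply (S : ContactStructure n M) {x : M} (u v : S.D x) :
    S.metric x u v = S.g x u v := by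
  rw [ContactStructure.metric, onVectors, dif_pos ⟨u.2, v.2⟩]

theorem existsUnique_metricProjection (H : IsSymmetricQuotient S U α X₀ π) [T2Space M] :
    ∃! g, IsMetricProjection S U π g := by
  obtain ⟨g, hs, hp⟩ := H.exists_projection (b := S.metric)
    (fun V X Y hV _ hX hY => S.smooth V X Y hV hX hY)
    (fun V X Y hV hVU hX hY x hx => by
      have := H.h_zero V X Y hV hVU hX hY x hx
      rw [hForm] at this
      linarith)
    (fun x _ => ⟨S.g x, metric_apply S⟩)
  refine ⟨g, ⟨⟨hs, ?_, ?_⟩, hp⟩, fun g' hg' => H.projection_unique hg'.pullback hp⟩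
  · intro y w w'
    obtain ⟨x, hx, rfl⟩ : y ∈ π '' U := by rw [H.quotient.surjective]; trivial
    obtain ⟨u, hu, rfl⟩ := H.exists_horizontal hx w
    obtain ⟨v, hv, rfl⟩ := H.exists_horizontal hx w'
    rw [hp x hx u hu v hv, hp x hx v hv u hu]
    exact (metric_apply S ⟨u, hu⟩ ⟨v, hv⟩).trans
      ((S.symm _ _ _).trans (metric_apply S ⟨v, hv⟩ ⟨u, hu⟩).symm)
  · intro y w h
    obtain ⟨x, hx, rfl⟩ : y ∈ π '' U := by rw [H.quotient.surjective]; trivial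
    obtain ⟨u, hu, rfl⟩ := H.exists_horizontal hx w
    have h0 : (⟨u, hu⟩ : S.D x) = 0 := by
      refine S.nondeg x _ fun v => ?_
      rw [← metric_apply S, ← hp x hx u hu v v.2]
      exact h _
    have : u = 0 := congrArg Subtype.val h0
    rw [this, map_zero]

theorem contMDiffOn_omegaForm (H : IsSymmetricQuotient S U α X₀ π) {V : Set M}
    {X Y : Π x : M, TangentSpace (𝓡 (2 * n + 1)) x} (hV : IsOpen V) (hVU : V ⊆ U)
    (hX : SmoothFieldOn X V) (hY : SmoothFieldOn Y V) :
    ContMDiffOn (𝓡 (2 * n + 1)) 𝓘(ℝ, ℝ) ∞ (fun x => omegaForm α x (X x) (Y x)) V := by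
  intro x hx
  have hxx := mem_extChartAt_source (I := 𝓡 (2 * n + 1)) x
  refine ContMDiffAt.contMDiffWithinAt ((contMDiffAt_iff_chart hxx).2 ?_)
  have hA := (smoothOneFormOn_contDiffAt H.quotient.isOpen H.smooth_form hxx (hVU hx)).fderiv_right
    (m := ∞) (by simp)
  have hX' := smoothFieldOn_contDiffAt hV hX hxx hx
  have hY' := smoothFieldOn_contDiffAt hV hY hxx hx
  refine ((((hA.clm_apply hX').clm_apply hY').sub
    ((hA.clm_apply hY').clm_apply hX')).neg).congr_of_eventuallyEq ?_
  have hev : ∀ᶠ e in 𝓝 (extChartAt (𝓡 (2 * n + 1)) x x),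
      (extChartAt (𝓡 (2 * n + 1)) x).symm e ∈ V := by
    refine (continuousAt_extChartAt_symm x).eventually (hV.mem_nhds ?_)
    rwa [(extChartAt (𝓡 (2 * n + 1)) x).left_inv hxx]
  filter_upwards [hev, (isOpen_extChartAt_target x).mem_nhds
    ((extChartAt (𝓡 (2 * n + 1)) x).map_source hxx)] with e he het
  have hy := (extChartAt (𝓡 (2 * n + 1)) x).map_target het
  rw [omegaForm, extDerivForm_eq H.quotient.isOpen H.smooth_form hy (hVU he),
    (extChartAt (𝓡 (2 * n + 1)) x).right_inv het]
  rfl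

/-- The alternating form `A u v - A v u`. -/
def antisymmetrization {E : Type*} [NormedAddCommGroup E] [NormedSpace ℝ E]
    (A : E →L[ℝ] E →L[ℝ] ℝ) : E →ₗ[ℝ] E →ₗ[ℝ] ℝ :=
  LinearMap.mk₂ ℝ (fun u v => A u v - A v u)
    (fun u u' v => by simp only [map_add, _root_.add_apply]; ring)
    (fun c u v => by simp only [map_smul, _root_.smul_apply, smul_eq_mul]; ring)
    (fun u v v' => by simp only [map_add, _root_.add_apply]; ring)
    (fun c u v => by simp only [map_smul, _root_.smul_apply, smul_eq_mul]; ring)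

/-- The exterior derivative as a bilinear form. -/
def extDerivBilin {m : ℕ} {M : Type*} [TopologicalSpace M]
    [ChartedSpace (EuclideanSpace ℝ (Fin m)) M] (α : Π x : M, TangentSpace (𝓡 m) x →L[ℝ] ℝ)
    (x : M) : TangentSpace (𝓡 m) x →ₗ[ℝ] TangentSpace (𝓡 m) x →ₗ[ℝ] ℝ :=
  (antisymmetrization (fderiv ℝ (chartForm α x) (extChartAt (𝓡 m) x x))).compl₁₂
    (dchart x x).toLinearMap (dchart x x).toLinearMap

theorem extDerivForm_swap {m : ℕ} {M : Type*} [TopologicalSpace M]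
    [ChartedSpace (EuclideanSpace ℝ (Fin m)) M] (α : Π x : M, TangentSpace (𝓡 m) x →L[ℝ] ℝ)
    (x : M) (u v : TangentSpace (𝓡 m) x) : extDerivForm α x u v = -extDerivForm α x v u := by
  simp only [extDerivForm]; ring

theorem existsUnique_omegaProjection (H : IsSymmetricQuotient S U α X₀ π) [T2Space M] :
    ∃! Ω, IsOmegaProjection S U α π Ω := by
  obtain ⟨Ω, hs, hp⟩ := H.exists_projection (b := omegaForm α)
    (fun V X Y hV hVU hX hY => H.contMDiffOn_omegaForm hV hVU hX.smooth hY.smooth)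
    H.omega_inv
    (fun x _ => ⟨-(extDerivBilin α x).compl₁₂ (S.D x).subtype (S.D x).subtype, fun _ _ => rfl⟩)
  refine ⟨Ω, ⟨⟨hs, ?_⟩, hp⟩, fun Ω' hΩ' => H.projection_unique hΩ'.pullback hp⟩
  intro y w
  obtain ⟨x, hx, rfl⟩ : y ∈ π '' U := by rw [H.quotient.surjective]; trivial
  obtain ⟨u, hu, rfl⟩ := H.exists_horizontal hx w
  rw [hp x hx u hu u hu, omegaForm]
  have := extDerivForm_swap α x u u
  linarith

/-- The exterior derivative of the contact form is the pullback of `-Ω`. -/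
theorem extDerivForm_eq_pullback (H : IsSymmetricQuotient S U α X₀ π) [T2Space M]
    {Ω : Π y : N, TangentSpace (𝓡 (2 * n)) y →L[ℝ] TangentSpace (𝓡 (2 * n)) y →L[ℝ] ℝ}
    (hΩ : IsOmegaProjection S U α π Ω) {x : M} (hx : x ∈ U)
    (u v : TangentSpace (𝓡 (2 * n + 1)) x) :
    extDerivForm α x u v = -Ω (π x) (mfderiv (𝓡 (2 * n + 1)) (𝓡 (2 * n)) π x u)
      (mfderiv (𝓡 (2 * n + 1)) (𝓡 (2 * n)) π x v) := by
  -- On `D` the identity is the definition of `Ω`; the `X₀` components contribute nothing, since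
  -- `dα(X₀,·) = 0` and `dπ X₀ = 0`.
  have hdec : ∀ u : TangentSpace (𝓡 (2 * n + 1)) x, ∃ u' ∈ S.D x, ∃ c : ℝ, u = u' + c • X₀ x :=
    fun u => ⟨u - α x u • X₀ x, by
      rw [H.mem_D_iff hx, map_sub, map_smul, H.reeb.one x hx]; simp, α x u, by simp⟩
  obtain ⟨u, hu, c, rfl⟩ := hdec u
  obtain ⟨v, hv, d, rfl⟩ := hdec v
  have h1 : ∀ w, extDerivBilin α x (X₀ x) w = 0 := H.reeb.ker x hx
  have h2 : ∀ w, extDerivBilin α x w (X₀ x) = 0 := fun w => by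
    have h3 := h1 w
    have h4 : extDerivBilin α x w (X₀ x) = -extDerivBilin α x (X₀ x) w := extDerivForm_swap α x _ _
    rw [h4, h3, neg_zero]
  have h5 := hΩ.pullback x hx u hu v hv
  rw [omegaForm] at h5
  have h6 : extDerivBilin α x (u + c • X₀ x) (v + d • X₀ x) = extDerivBilin α x u v := by
    simp [h1, h2]
  refine h6.trans ?_
  have hdu : ∀ (w : TangentSpace (𝓡 (2 * n + 1)) x) (r : ℝ),
      mfderiv (𝓡 (2 * n + 1)) (𝓡 (2 * n)) π x (w + r • X₀ x)
        = mfderiv (𝓡 (2 * n + 1)) (𝓡 (2 * n)) π x w := fun w r => by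
    rw [map_add, map_smul, H.mfderiv_reeb hx, smul_zero, add_zero]
  rw [hdu, hdu, h5, neg_neg]
  rfl

end IsSymmetricQuotient

end Projection

/-! ### From local diffeomorphisms of the model space to diffeomorphisms of manifolds. -/

section Equivalence

open Filter Topology

section Diffeo

variable {m : ℕ} {M₁ : Type*} [TopologicalSpace M₁]
  [ChartedSpace (EuclideanSpace ℝ (Fin m)) M₁]
  {M₂ : Type*} [TopologicalSpace M₂]
  [ChartedSpace (EuclideanSpace ℝ (Fin m)) M₂]

theorem IsDiffeo.bijective_mfderiv {φ : OpenPartialHomeomorph M₁ M₂} (hφ : IsDiffeo (m := m) φ)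
    {y : M₁} (hy : y ∈ φ.source) : Function.Bijective (mfderiv (𝓡 m) (𝓡 m) φ y) := by
  have h1 : MDifferentiableAt (𝓡 m) (𝓡 m) φ y :=
    (hφ.smooth.contMDiffAt (φ.open_source.mem_nhds hy)).mdifferentiableAt (by simp)
  have h2 : MDifferentiableAt (𝓡 m) (𝓡 m) φ.symm (φ y) :=
    (hφ.smooth_symm.contMDiffAt (φ.open_target.mem_nhds (φ.map_source hy))).mdifferentiableAt
      (by simp)
  have h3 := mfderiv_comp y h2 h1
  have h4 : φ.symm ∘ φ =ᶠ[𝓝 y] id := by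
    filter_upwards [φ.open_source.mem_nhds hy] with z hz using φ.left_inv hz
  have hinj : Function.Injective (mfderiv (𝓡 m) (𝓡 m) φ y) := by
    rw [injective_iff_map_eq_zero]
    intro u hu
    have h5 : mfderiv (𝓡 m) (𝓡 m) (φ.symm ∘ φ) y u = 0 := by
      rw [h3]
      change mfderiv (𝓡 m) (𝓡 m) φ.symm (φ y) (mfderiv (𝓡 m) (𝓡 m) φ y u) = 0
      rw [hu, map_zero]
    rw [h4.mfderiv_eq, mfderiv_id] at h5
    exact h5
  let A : EuclideanSpace ℝ (Fin m) →L[ℝ] EuclideanSpace ℝ (Fin m) := mfderiv (𝓡 m) (𝓡 m) φ y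
  exact ⟨hinj, (LinearMap.injective_iff_surjective (f := A.toLinearMap)).1 hinj⟩

variable [IsManifold (𝓡 m) ∞ M₁] [IsManifold (𝓡 m) ∞ M₂]

/-- A local diffeomorphism of the model space gives, in charts, a local diffeomorphism of
manifolds. -/
theorem exists_diffeo_of_chart {p₁ : M₁} {p₂ : M₂}
    {f : EuclideanSpace ℝ (Fin m) → EuclideanSpace ℝ (Fin m)}
    (hf : ∀ᶠ e in 𝓝 (extChartAt (𝓡 m) p₁ p₁), ContDiffAt ℝ ∞ f e)
    (hfp : f (extChartAt (𝓡 m) p₁ p₁) = extChartAt (𝓡 m) p₂ p₂)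
    (hinv : (fderiv ℝ f (extChartAt (𝓡 m) p₁ p₁)).IsInvertible)
    {Q : M₁ → Prop} (hQ : ∀ᶠ x in 𝓝 p₁, Q x) :
    ∃ F : OpenPartialHomeomorph M₁ M₂, IsDiffeo (m := m) F ∧ p₁ ∈ F.source ∧ F p₁ = p₂ ∧
      (∀ x, F x = (extChartAt (𝓡 m) p₂).symm (f (extChartAt (𝓡 m) p₁ x))) ∧
      ∀ x ∈ F.source, Q x ∧ x ∈ (extChartAt (𝓡 m) p₁).source ∧
        F x ∈ (extChartAt (𝓡 m) p₂).source ∧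
        extChartAt (𝓡 m) p₂ (F x) = f (extChartAt (𝓡 m) p₁ x) := by
  obtain ⟨Φ, h0, hΦ, hs, ht⟩ := exists_smooth_inverse hf hinv
  obtain ⟨O, hOQ, hO, hpO⟩ := eventually_nhds_iff.1 hQ
  have hp1 := mem_extChartAt_source (I := 𝓡 m) p₁
  have hp2 := mem_extChartAt_source (I := 𝓡 m) p₂
  let F₀ : OpenPartialHomeomorph M₁ M₂ :=
    ((chartAt (EuclideanSpace ℝ (Fin m)) p₁).trans Φ).trans
      (chartAt (EuclideanSpace ℝ (Fin m)) p₂).symm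
  have hF₀ : ∀ x, F₀ x = (extChartAt (𝓡 m) p₂).symm (f (extChartAt (𝓡 m) p₁ x)) := fun x => by
    rw [← hΦ]; rfl
  have hF₀s : ∀ z, F₀.symm z = (extChartAt (𝓡 m) p₁).symm (Φ.symm (extChartAt (𝓡 m) p₂ z)) :=
    fun z => rfl
  have hsrc : ∀ x, x ∈ F₀.source ↔ x ∈ (extChartAt (𝓡 m) p₁).source ∧
      extChartAt (𝓡 m) p₁ x ∈ Φ.source ∧
      f (extChartAt (𝓡 m) p₁ x) ∈ (extChartAt (𝓡 m) p₂).target := fun x => by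
    rw [← hΦ]
    simp [F₀, and_assoc]
  have htgt : ∀ z, z ∈ F₀.target ↔ z ∈ (extChartAt (𝓡 m) p₂).source ∧
      extChartAt (𝓡 m) p₂ z ∈ Φ.target ∧
      Φ.symm (extChartAt (𝓡 m) p₂ z) ∈ (extChartAt (𝓡 m) p₁).target := fun z => by
    simp [F₀]
  have hF : IsDiffeo (m := m) F₀ := by
    refine ⟨fun x hx => ContMDiffAt.contMDiffWithinAt ?_,
      fun z hz => ContMDiffAt.contMDiffWithinAt ?_⟩
    · obtain ⟨h1, h2, h3⟩ := (hsrc x).1 hx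
      have h4 := (contMDiffAt_chart_symm h3).comp x
        ((hs _ h2).1.contMDiffAt.comp x (contMDiffAt_chart h1))
      exact h4.congr_of_eventuallyEq (Eventually.of_forall hF₀)
    · obtain ⟨h1, h2, h3⟩ := (htgt z).1 hz
      have h4 := (contMDiffAt_chart_symm h3).comp z
        ((ht _ h2).contMDiffAt.comp z (contMDiffAt_chart h1))
      exact h4.congr_of_eventuallyEq (Eventually.of_forall hF₀s)
  have hsub : ∀ x ∈ (F₀.restrOpen O hO).source, x ∈ F₀.source ∧ x ∈ O := fun x hx => by
    rwa [OpenPartialHomeomorph.restrOpen_source] at hx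
  -- Restricting to `O` turns a property that holds near `p₁` into one that holds on the whole
  -- source.
  refine ⟨F₀.restrOpen O hO, ⟨hF.smooth.mono fun x hx => (hsub x hx).1,
    hF.smooth_symm.mono fun z hz => ?_⟩, ?_, ?_, hF₀, fun x hx => ?_⟩
  · exact hz.1
  · rw [OpenPartialHomeomorph.restrOpen_source]
    exact ⟨(hsrc p₁).2 ⟨hp1, h0, by rw [hfp]; exact (extChartAt (𝓡 m) p₂).map_source hp2⟩, hpO⟩
  · refine (hF₀ p₁).trans ?_
    rw [hfp, (extChartAt (𝓡 m) p₂).left_inv hp2]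
  · obtain ⟨h1, h2, h3⟩ := (hsrc x).1 (hsub x hx).1
    refine ⟨hOQ x (hsub x hx).2, h1, ?_, ?_⟩
    · change F₀ x ∈ _
      rw [hF₀]
      exact (extChartAt (𝓡 m) p₂).map_target h3
    · change extChartAt (𝓡 m) p₂ (F₀ x) = _
      rw [hF₀, (extChartAt (𝓡 m) p₂).right_inv h3]

end Diffeo

end Equivalence

/-! ### Construction of the local isometry over `φ`. -/

section LocalIsometry

open Filter Topology

section Congr

variable {k : ℕ} {N : Type*} [TopologicalSpace N] [ChartedSpace (EuclideanSpace ℝ (Fin k)) N]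
  (B : Π y : N, TangentSpace (𝓡 k) y →L[ℝ] TangentSpace (𝓡 k) y →L[ℝ] ℝ)

/-- Serves base points such as `π₂ (f x)` and `φ (π₁ x)`, which are only propositionally equal:
their tangent spaces share the model space, where the vectors can be compared. -/
theorem bilin_congr {y y' : N} (h : y = y') {w v : TangentSpace (𝓡 k) y}
    {w' v' : TangentSpace (𝓡 k) y'} (hw : (w : EuclideanSpace ℝ (Fin k)) = w')
    (hv : (v : EuclideanSpace ℝ (Fin k)) = v') : B y w v = B y' w' v' := by
  subst h
  have hw : w = w' := hw
  have hv : v = v' := hv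
  rw [hw, hv]

theorem bilin_congr_of_dchart [IsManifold (𝓡 k) ∞ N] {y y' q : N} (h : y = y')
    (hq : y ∈ (extChartAt (𝓡 k) q).source) {w v : TangentSpace (𝓡 k) y}
    {w' v' : TangentSpace (𝓡 k) y'} (hw : dchart q y w = dchart q y' w')
    (hv : dchart q y v = dchart q y' v') : B y w v = B y' w' v' := by
  subst h
  rw [(isInvertible_dchart hq).bijective.injective hw,
    (isInvertible_dchart hq).bijective.injective hv]

end Congr

variable {n : ℕ}
  {M₁ : Type*} [TopologicalSpace M₁] [T2Space M₁]
  [ChartedSpace (EuclideanSpace ℝ (Fin (2 * n + 1))) M₁] [IsManifold (𝓡 (2 * n + 1)) ∞ M₁]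
  {M₂ : Type*} [TopologicalSpace M₂] [T2Space M₂]
  [ChartedSpace (EuclideanSpace ℝ (Fin (2 * n + 1))) M₂] [IsManifold (𝓡 (2 * n + 1)) ∞ M₂]
  {N₁ : Type*} [TopologicalSpace N₁]
  [ChartedSpace (EuclideanSpace ℝ (Fin (2 * n))) N₁] [IsManifold (𝓡 (2 * n)) ∞ N₁]
  {N₂ : Type*} [TopologicalSpace N₂]
  [ChartedSpace (EuclideanSpace ℝ (Fin (2 * n))) N₂] [IsManifold (𝓡 (2 * n)) ∞ N₂]
  {S₁ : ContactStructure n M₁} {S₂ : ContactStructure n M₂} {U₁ : Set M₁} {U₂ : Set M₂}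
  {α₁ : Π x : M₁, TangentSpace (𝓡 (2 * n + 1)) x →L[ℝ] ℝ}
  {α₂ : Π x : M₂, TangentSpace (𝓡 (2 * n + 1)) x →L[ℝ] ℝ}
  {X₁ : Π x : M₁, TangentSpace (𝓡 (2 * n + 1)) x}
  {X₂ : Π x : M₂, TangentSpace (𝓡 (2 * n + 1)) x}
  {π₁ : M₁ → N₁} {π₂ : M₂ → N₂} {φ : OpenPartialHomeomorph N₁ N₂}

namespace IsSymmetricQuotient

theorem contMDiffAt_comp (H₁ : IsSymmetricQuotient S₁ U₁ α₁ X₁ π₁) (hφ : IsDiffeo (m := 2 * n) φ)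
    {x : M₁} (hx : x ∈ U₁) (hxφ : π₁ x ∈ φ.source) :
    ContMDiffAt (𝓡 (2 * n + 1)) (𝓡 (2 * n)) ∞ (fun x => φ (π₁ x)) x :=
  (hφ.smooth.contMDiffAt (φ.open_source.mem_nhds hxφ)).comp x (H₁.contMDiffAt hx)

theorem mfderiv_comp (H₁ : IsSymmetricQuotient S₁ U₁ α₁ X₁ π₁) (hφ : IsDiffeo (m := 2 * n) φ)
    {x : M₁} (hx : x ∈ U₁) (hxφ : π₁ x ∈ φ.source) (u : TangentSpace (𝓡 (2 * n + 1)) x) :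
    mfderiv (𝓡 (2 * n + 1)) (𝓡 (2 * n)) (fun x => φ (π₁ x)) x u =
      mfderiv (𝓡 (2 * n)) (𝓡 (2 * n)) φ (π₁ x)
        (mfderiv (𝓡 (2 * n + 1)) (𝓡 (2 * n)) π₁ x u) :=
  DFunLike.congr_fun (_root_.mfderiv_comp x
    ((hφ.smooth.contMDiffAt (φ.open_source.mem_nhds hxφ)).mdifferentiableAt (by simp))
    (H₁.mdifferentiableAt hx)) u

/-- A vector in the kernel is killed by `dπ₁`, as `dφ` is injective, and by `α₁`, so it is zero;
equal dimensions give the rest. -/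
theorem isInvertible_chart_splitting_comp (H₁ : IsSymmetricQuotient S₁ U₁ α₁ X₁ π₁)
    (hφ : IsDiffeo (m := 2 * n) φ) {x p : M₁} (hx : x ∈ U₁)
    (hp : x ∈ (extChartAt (𝓡 (2 * n + 1)) p).source) (hxφ : π₁ x ∈ φ.source)
    {q : N₂} (hq : φ (π₁ x) ∈ (extChartAt (𝓡 (2 * n)) q).source) :
    ((fderiv ℝ (chartMap (m := 2 * n + 1) (k := 2 * n) (fun x => φ (π₁ x)) p q)
      (extChartAt (𝓡 (2 * n + 1)) p x)).prod
      (chartForm α₁ p (extChartAt (𝓡 (2 * n + 1)) p x))).IsInvertible := by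
  set A := (fderiv ℝ (chartMap (m := 2 * n + 1) (k := 2 * n) (fun x => φ (π₁ x)) p q)
      (extChartAt (𝓡 (2 * n + 1)) p x)).prod (chartForm α₁ p (extChartAt (𝓡 (2 * n + 1)) p x))
    with hA
  have hinj : Function.Injective A.toLinearMap := by
    rw [injective_iff_map_eq_zero]
    intro w hw
    obtain ⟨u, rfl⟩ := (isInvertible_dchart hp).bijective.surjective w
    have h1 := congrArg Prod.fst hw
    have h2 : chartForm α₁ p (extChartAt (𝓡 (2 * n + 1)) p x) (dchart p x u) = 0 :=
      congrArg Prod.snd hw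
    have h3 := (fderiv_chartMap (f := fun x => φ (π₁ x)) hp
      ((H₁.contMDiffAt_comp hφ hx hxφ).mdifferentiableAt (by simp)) hq u).symm.trans h1
    rw [chartForm_dchart α₁ hp] at h2
    have h4 := (isInvertible_dchart hq).bijective.injective (h3.trans (map_zero _).symm)
    have h5 := (hφ.bijective_mfderiv hxφ).injective
      (((H₁.mfderiv_comp hφ hx hxφ u).symm.trans h4).trans (map_zero _).symm)
    rw [H₁.eq_zero_of_horizontal hx h5 h2, map_zero]
  have hsurj := (LinearMap.injective_iff_surjective_of_finrank_eq_finrank (by simp)).1 hinj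
  exact ⟨(LinearEquiv.ofBijective A.toLinearMap ⟨hinj, hsurj⟩).toContinuousLinearEquiv, rfl⟩

/-- Both sides are, up to sign, values of `Ω₂` on the same pair of vectors, because `φ^*Ω₂ = Ω₁`.
This is the matching condition that makes the difference form on the fibre product closed. -/
theorem extDerivForm_eq_extDerivForm (H₁ : IsSymmetricQuotient S₁ U₁ α₁ X₁ π₁)
    (H₂ : IsSymmetricQuotient S₂ U₂ α₂ X₂ π₂)
    {Ω₁ : Π y : N₁, TangentSpace (𝓡 (2 * n)) y →L[ℝ] TangentSpace (𝓡 (2 * n)) y →L[ℝ] ℝ}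
    {Ω₂ : Π y : N₂, TangentSpace (𝓡 (2 * n)) y →L[ℝ] TangentSpace (𝓡 (2 * n)) y →L[ℝ] ℝ}
    (hΩ₁ : IsOmegaProjection S₁ U₁ α₁ π₁ Ω₁) (hΩ₂ : IsOmegaProjection S₂ U₂ α₂ π₂ Ω₂)
    (hφ : IsDiffeo (m := 2 * n) φ) (hφΩ : PullsBack φ Ω₂ Ω₁) {x : M₁} (hx : x ∈ U₁)
    (hxφ : π₁ x ∈ φ.source) {z : M₂} (hz : z ∈ U₂) (hxz : φ (π₁ x) = π₂ z) {q : N₂}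
    (hq : φ (π₁ x) ∈ (extChartAt (𝓡 (2 * n)) q).source)
    {u v : TangentSpace (𝓡 (2 * n + 1)) x} {u' v' : TangentSpace (𝓡 (2 * n + 1)) z}
    (hu : dchart q (φ (π₁ x)) (mfderiv (𝓡 (2 * n + 1)) (𝓡 (2 * n)) (fun x => φ (π₁ x)) x u) =
      dchart q (π₂ z) (mfderiv (𝓡 (2 * n + 1)) (𝓡 (2 * n)) π₂ z u'))
    (hv : dchart q (φ (π₁ x)) (mfderiv (𝓡 (2 * n + 1)) (𝓡 (2 * n)) (fun x => φ (π₁ x)) x v) =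
      dchart q (π₂ z) (mfderiv (𝓡 (2 * n + 1)) (𝓡 (2 * n)) π₂ z v')) :
    extDerivForm α₁ x u v = extDerivForm α₂ z u' v' := by
  rw [H₁.extDerivForm_eq_pullback hΩ₁ hx, H₂.extDerivForm_eq_pullback hΩ₂ hz, ← hφΩ _ hxφ,
    ← bilin_congr_of_dchart Ω₂ hxz hq hu hv]
  refine congrArg Neg.neg (bilin_congr Ω₂ rfl ?_ ?_)
  · exact (H₁.mfderiv_comp hφ hx hxφ u).symm
  · exact (H₁.mfderiv_comp hφ hx hxφ v).symm

/-- In charts, the two structures are related by a local diffeomorphism preserving the contact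
forms and covering `φ`. -/
theorem exists_chart_equivalence (H₁ : IsSymmetricQuotient S₁ U₁ α₁ X₁ π₁)
    (H₂ : IsSymmetricQuotient S₂ U₂ α₂ X₂ π₂)
    {Ω₁ : Π y : N₁, TangentSpace (𝓡 (2 * n)) y →L[ℝ] TangentSpace (𝓡 (2 * n)) y →L[ℝ] ℝ}
    {Ω₂ : Π y : N₂, TangentSpace (𝓡 (2 * n)) y →L[ℝ] TangentSpace (𝓡 (2 * n)) y →L[ℝ] ℝ}
    (hΩ₁ : IsOmegaProjection S₁ U₁ α₁ π₁ Ω₁) (hΩ₂ : IsOmegaProjection S₂ U₂ α₂ π₂ Ω₂)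
    (hφ : IsDiffeo (m := 2 * n) φ) (hφΩ : PullsBack φ Ω₂ Ω₁) {p₁ : M₁} (hp₁ : p₁ ∈ U₁)
    {p₂ : M₂} (hp₂ : p₂ ∈ U₂) (hpφ : π₁ p₁ ∈ φ.source) (hpp : φ (π₁ p₁) = π₂ p₂) :
    ∃ f : EuclideanSpace ℝ (Fin (2 * n + 1)) → EuclideanSpace ℝ (Fin (2 * n + 1)),
      (∀ᶠ e in 𝓝 (extChartAt (𝓡 (2 * n + 1)) p₁ p₁), ContDiffAt ℝ ∞ f e) ∧
      f (extChartAt (𝓡 (2 * n + 1)) p₁ p₁) = extChartAt (𝓡 (2 * n + 1)) p₂ p₂ ∧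
      (fderiv ℝ f (extChartAt (𝓡 (2 * n + 1)) p₁ p₁)).IsInvertible ∧
      ∀ᶠ e in 𝓝 (extChartAt (𝓡 (2 * n + 1)) p₁ p₁),
        chartMap (m := 2 * n + 1) (k := 2 * n) π₂ p₂ (π₂ p₂) (f e) =
          chartMap (m := 2 * n + 1) (k := 2 * n) (fun x => φ (π₁ x)) p₁ (π₂ p₂) e ∧
        (chartForm α₂ p₂ (f e)).comp (fderiv ℝ f e) = chartForm α₁ p₁ e := by
  have h1 := mem_extChartAt_source (I := 𝓡 (2 * n + 1)) p₁
  have h2 := mem_extChartAt_source (I := 𝓡 (2 * n + 1)) p₂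
  have hq : π₂ p₂ ∈ (extChartAt (𝓡 (2 * n)) (π₂ p₂)).source := mem_extChartAt_source _
  have hq' : φ (π₁ p₁) ∈ (extChartAt (𝓡 (2 * n)) (π₂ p₂)).source := by rwa [hpp]
  have hρ := H₁.contMDiffAt_comp hφ hp₁ hpφ
  have hev₁ : ∀ᶠ x in 𝓝 p₁, x ∈ (extChartAt (𝓡 (2 * n + 1)) p₁).source ∧ x ∈ U₁ ∧
      π₁ x ∈ φ.source ∧ φ (π₁ x) ∈ (extChartAt (𝓡 (2 * n)) (π₂ p₂)).source := by
    filter_upwards [(isOpen_extChartAt_source p₁).mem_nhds h1, H₁.quotient.isOpen.mem_nhds hp₁,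
      (H₁.contMDiffAt hp₁).continuousAt.eventually (φ.open_source.mem_nhds hpφ),
      hρ.continuousAt.eventually ((isOpen_extChartAt_source (π₂ p₂)).mem_nhds hq')]
      with x hx hx' hx'' hx''' using ⟨hx, hx', hx'', hx'''⟩
  have hev₂ : ∀ᶠ z in 𝓝 p₂, z ∈ (extChartAt (𝓡 (2 * n + 1)) p₂).source ∧ z ∈ U₂ ∧
      π₂ z ∈ (extChartAt (𝓡 (2 * n)) (π₂ p₂)).source := by
    filter_upwards [(isOpen_extChartAt_source p₂).mem_nhds h2, H₂.quotient.isOpen.mem_nhds hp₂,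
      (H₂.contMDiffAt hp₂).continuousAt.eventually
        ((isOpen_extChartAt_source (π₂ p₂)).mem_nhds hq)]
      with x hx hx' hx'' using ⟨hx, hx', hx''⟩
  have hl₁ := (extChartAt (𝓡 (2 * n + 1)) p₁).left_inv h1
  have hl₂ := (extChartAt (𝓡 (2 * n + 1)) p₂).left_inv h2
  have hE₁ : ∀ᶠ e in 𝓝 (extChartAt (𝓡 (2 * n + 1)) p₁ p₁),
      ∃ x, e = extChartAt (𝓡 (2 * n + 1)) p₁ x ∧ x ∈ (extChartAt (𝓡 (2 * n + 1)) p₁).source ∧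
      x ∈ U₁ ∧ π₁ x ∈ φ.source ∧ φ (π₁ x) ∈ (extChartAt (𝓡 (2 * n)) (π₂ p₂)).source := by
    have hc := continuousAt_extChartAt_symm (I := 𝓡 (2 * n + 1)) p₁
    rw [ContinuousAt, hl₁] at hc
    filter_upwards [hc.eventually hev₁, (isOpen_extChartAt_target p₁).mem_nhds
      ((extChartAt (𝓡 (2 * n + 1)) p₁).map_source h1)] with e he het
    exact ⟨_, ((extChartAt (𝓡 (2 * n + 1)) p₁).right_inv het).symm, he⟩
  have hE₂ : ∀ᶠ e in 𝓝 (extChartAt (𝓡 (2 * n + 1)) p₂ p₂),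
      ∃ z, e = extChartAt (𝓡 (2 * n + 1)) p₂ z ∧ z ∈ (extChartAt (𝓡 (2 * n + 1)) p₂).source ∧
      z ∈ U₂ ∧ π₂ z ∈ (extChartAt (𝓡 (2 * n)) (π₂ p₂)).source := by
    have hc := continuousAt_extChartAt_symm (I := 𝓡 (2 * n + 1)) p₂
    rw [ContinuousAt, hl₂] at hc
    filter_upwards [hc.eventually hev₂, (isOpen_extChartAt_target p₂).mem_nhds
      ((extChartAt (𝓡 (2 * n + 1)) p₂).map_source h2)] with e he het
    exact ⟨_, ((extChartAt (𝓡 (2 * n + 1)) p₂).right_inv het).symm, he⟩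
  -- Both `φ ∘ π₁` and `π₂` are read in the chart of `N₂` at `π₂ p₂`, so equality of coordinates is
  -- equality of points of `N₂`.
  refine exists_local_equivalence (R := chartMap (m := 2 * n + 1) (k := 2 * n)
      (fun x => φ (π₁ x)) p₁ (π₂ p₂)) (P := chartMap (m := 2 * n + 1) (k := 2 * n) π₂ p₂ (π₂ p₂))
    (a₁ := chartForm α₁ p₁) (a₂ := chartForm α₂ p₂) ?_ ?_ ?_ ?_ ?_
    (H₁.isInvertible_chart_splitting_comp hφ hp₁ h1 hpφ hq')
    (H₂.isInvertible_chart_splitting hp₂ h2 hq) ?_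
  · filter_upwards [hE₁] with e he
    obtain ⟨x, rfl, hx, hxU, -⟩ := he
    exact smoothOneFormOn_contDiffAt H₁.quotient.isOpen H₁.smooth_form hx hxU
  · filter_upwards [hE₂] with e he
    obtain ⟨x, rfl, hx, hxU, -⟩ := he
    exact smoothOneFormOn_contDiffAt H₂.quotient.isOpen H₂.smooth_form hx hxU
  · filter_upwards [hE₁] with e he
    obtain ⟨x, rfl, hx, hxU, hxφ, hxq⟩ := he
    exact contDiffAt_chartMap hx (H₁.contMDiffAt_comp hφ hxU hxφ) hxq
  · filter_upwards [hE₂] with e he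
    obtain ⟨x, rfl, hx, hxU, hxq⟩ := he
    exact contDiffAt_chartMap hx (H₂.contMDiffAt hxU) hxq
  · rw [chartMap_apply h1, chartMap_apply h2, hpp]
  · filter_upwards [hE₁.prod_nhds hE₂]
    rintro ⟨e, e'⟩ ⟨⟨x, he, hx, hxU, hxφ, hxq⟩, ⟨z, he', hz, hzU, hzq⟩⟩ hee u v u' v' hu hv
    simp only at he he'
    subst he he'
    simp only at hee hu hv ⊢
    rw [chartMap_apply hx, chartMap_apply hz] at hee
    have hxz : φ (π₁ x) = π₂ z := (extChartAt (𝓡 (2 * n)) (π₂ p₂)).injOn hxq hzq hee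
    obtain ⟨u, rfl⟩ := (isInvertible_dchart hx).bijective.surjective u
    obtain ⟨v, rfl⟩ := (isInvertible_dchart hx).bijective.surjective v
    obtain ⟨u', rfl⟩ := (isInvertible_dchart hz).bijective.surjective u'
    obtain ⟨v', rfl⟩ := (isInvertible_dchart hz).bijective.surjective v'
    have hρx := (H₁.contMDiffAt_comp hφ hxU hxφ).mdifferentiableAt (by simp)
    have hπz := H₂.mdifferentiableAt hzU
    have hu' := ((fderiv_chartMap hx hρx hxq u).symm.trans hu).trans
      (fderiv_chartMap hz hπz hzq u')
    have hv' := ((fderiv_chartMap hx hρx hxq v).symm.trans hv).trans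
      (fderiv_chartMap hz hπz hzq v')
    have h := H₁.extDerivForm_eq_extDerivForm H₂ hΩ₁ hΩ₂ hφ hφΩ hxU hxφ hzU hxz hxq hu' hv'
    rw [extDerivForm_eq H₁.quotient.isOpen H₁.smooth_form hx hxU,
      extDerivForm_eq H₂.quotient.isOpen H₂.smooth_form hz hzU] at h
    exact h

theorem exists_local_isometry (H₁ : IsSymmetricQuotient S₁ U₁ α₁ X₁ π₁)
    (H₂ : IsSymmetricQuotient S₂ U₂ α₂ X₂ π₂)
    {g₁ Ω₁ : Π y : N₁, TangentSpace (𝓡 (2 * n)) y →L[ℝ] TangentSpace (𝓡 (2 * n)) y →L[ℝ] ℝ}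
    {g₂ Ω₂ : Π y : N₂, TangentSpace (𝓡 (2 * n)) y →L[ℝ] TangentSpace (𝓡 (2 * n)) y →L[ℝ] ℝ}
    (hg₁ : IsMetricProjection S₁ U₁ π₁ g₁) (hΩ₁ : IsOmegaProjection S₁ U₁ α₁ π₁ Ω₁)
    (hg₂ : IsMetricProjection S₂ U₂ π₂ g₂) (hΩ₂ : IsOmegaProjection S₂ U₂ α₂ π₂ Ω₂)
    (hφ : IsDiffeo (m := 2 * n) φ) (hφg : PullsBack φ g₂ g₁) (hφΩ : PullsBack φ Ω₂ Ω₁)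
    {p₁ : M₁} (hp₁ : p₁ ∈ U₁)
    {p₂ : M₂} (hp₂ : p₂ ∈ U₂) (hpφ : π₁ p₁ ∈ φ.source) (hpp : φ (π₁ p₁) = π₂ p₂) :
    ∃ f : OpenPartialHomeomorph M₁ M₂, IsSubIsometry S₁ S₂ f ∧
      p₁ ∈ f.source ∧ f p₁ = p₂ ∧ f.source ⊆ U₁ ∧ f.target ⊆ U₂ ∧
      ∀ x ∈ f.source, π₁ x ∈ φ.source ∧ π₂ (f x) = φ (π₁ x) := by
  obtain ⟨f, hf, hfp, hinv, hfe⟩ :=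
    H₁.exists_chart_equivalence H₂ hΩ₁ hΩ₂ hφ hφΩ hp₁ hp₂ hpφ hpp
  have h1 := mem_extChartAt_source (I := 𝓡 (2 * n + 1)) p₁
  have h2 := mem_extChartAt_source (I := 𝓡 (2 * n + 1)) p₂
  have hq : π₂ p₂ ∈ (extChartAt (𝓡 (2 * n)) (π₂ p₂)).source := mem_extChartAt_source _
  have hq' : φ (π₁ p₁) ∈ (extChartAt (𝓡 (2 * n)) (π₂ p₂)).source := by rwa [hpp]
  have hc₁ := (contMDiffAt_chart h1).continuousAt
  have hc : ContinuousAt (fun x => (extChartAt (𝓡 (2 * n + 1)) p₂).symm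
      (f (extChartAt (𝓡 (2 * n + 1)) p₁ x))) p₁ := by
    have hs := continuousAt_extChartAt_symm (I := 𝓡 (2 * n + 1)) p₂
    rw [← hfp] at hs
    exact ContinuousAt.comp (f := fun x => f (extChartAt (𝓡 (2 * n + 1)) p₁ x)) hs
      (ContinuousAt.comp (f := extChartAt (𝓡 (2 * n + 1)) p₁) hf.self_of_nhds.continuousAt hc₁)
  have hQ : ∀ᶠ x in 𝓝 p₁, (x ∈ U₁ ∧ π₁ x ∈ φ.source ∧
      φ (π₁ x) ∈ (extChartAt (𝓡 (2 * n)) (π₂ p₂)).source) ∧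
      (extChartAt (𝓡 (2 * n + 1)) p₂).symm (f (extChartAt (𝓡 (2 * n + 1)) p₁ x)) ∈
        U₂ ∩ π₂ ⁻¹' (extChartAt (𝓡 (2 * n)) (π₂ p₂)).source ∧
      chartMap (m := 2 * n + 1) (k := 2 * n) π₂ p₂ (π₂ p₂) (f (extChartAt (𝓡 (2 * n + 1)) p₁ x)) =
        chartMap (m := 2 * n + 1) (k := 2 * n) (fun x => φ (π₁ x)) p₁ (π₂ p₂)
          (extChartAt (𝓡 (2 * n + 1)) p₁ x) ∧
      (chartForm α₂ p₂ (f (extChartAt (𝓡 (2 * n + 1)) p₁ x))).comp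
        (fderiv ℝ f (extChartAt (𝓡 (2 * n + 1)) p₁ x)) =
          chartForm α₁ p₁ (extChartAt (𝓡 (2 * n + 1)) p₁ x) := by
    filter_upwards [H₁.quotient.isOpen.mem_nhds hp₁,
      (H₁.contMDiffAt hp₁).continuousAt.eventually (φ.open_source.mem_nhds hpφ),
      (H₁.contMDiffAt_comp hφ hp₁ hpφ).continuousAt.eventually
        ((isOpen_extChartAt_source (π₂ p₂)).mem_nhds hq'),
      hc.eventually ((H₂.isOpen_domain (π₂ p₂)).mem_nhds (by
        beta_reduce
        rw [hfp, (extChartAt (𝓡 (2 * n + 1)) p₂).left_inv h2]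
        exact ⟨hp₂, hq⟩)),
      hc₁.eventually hfe] with x hx hx' hx'' hx3 hx4 using ⟨⟨hx, hx', hx''⟩, hx3, hx4⟩
  obtain ⟨F, hF, hpF, hFp, hFf, hFs⟩ := exists_diffeo_of_chart hf hfp hinv hQ
  have hU : ∀ x ∈ F.source, x ∈ U₁ ∧ π₁ x ∈ φ.source ∧ F x ∈ U₂ ∧ π₂ (F x) = φ (π₁ x) := by
    intro x hx
    obtain ⟨⟨⟨hxU, hxφ, hxq⟩, hFU, hP, -⟩, hxs, hFxs, hFx⟩ := hFs x hx
    rw [← hFf] at hFU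
    refine ⟨hxU, hxφ, hFU.1, ?_⟩
    rw [← hFx, chartMap_apply hFxs, chartMap_apply hxs] at hP
    exact (extChartAt (𝓡 (2 * n)) (π₂ p₂)).injOn hFU.2 hxq hP
  have hFd : ∀ x ∈ F.source, MDifferentiableAt (𝓡 (2 * n + 1)) (𝓡 (2 * n + 1)) F x := fun x hx =>
    (hF.smooth.contMDiffAt (F.open_source.mem_nhds hx)).mdifferentiableAt (by simp)
  have hform : ∀ x ∈ F.source, ∀ u : TangentSpace (𝓡 (2 * n + 1)) x,
      α₂ (F x) (mfderiv (𝓡 (2 * n + 1)) (𝓡 (2 * n + 1)) F x u) = α₁ x u := by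
    intro x hx u
    obtain ⟨⟨-, -, -, ha⟩, hxs, hFxs, hFx⟩ := hFs x hx
    -- `F` in charts coincides with `f` near every point of its source, so the identity `a₂ ∘ df =
    -- a₁` passes to `dF`.
    have hev : chartMap (m := 2 * n + 1) (k := 2 * n + 1) F p₁ p₂
        =ᶠ[𝓝 (extChartAt (𝓡 (2 * n + 1)) p₁ x)] f := by
      have hs := continuousAt_extChartAt_symm' (I := 𝓡 (2 * n + 1)) hxs
      rw [ContinuousAt, (extChartAt (𝓡 (2 * n + 1)) p₁).left_inv hxs] at hs
      filter_upwards [hs.eventually (F.open_source.mem_nhds hx),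
        (isOpen_extChartAt_target p₁).mem_nhds
          ((extChartAt (𝓡 (2 * n + 1)) p₁).map_source hxs)] with e he het
      have h := (hFs _ he).2.2.2
      rwa [(extChartAt (𝓡 (2 * n + 1)) p₁).right_inv het] at h
    have h3 := fderiv_chartMap hxs (hFd x hx) hFxs u
    rw [hev.fderiv_eq] at h3
    have h4 := DFunLike.congr_fun ha (dchart p₁ x u)
    have h5 := chartForm_dchart α₂ hFxs (mfderiv (𝓡 (2 * n + 1)) (𝓡 (2 * n + 1)) F x u)
    rw [← h3, hFx] at h5
    exact h5.symm.trans (h4.trans (chartForm_dchart α₁ hxs u))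
  have hproj : ∀ x ∈ F.source, ∀ u : TangentSpace (𝓡 (2 * n + 1)) x,
      (mfderiv (𝓡 (2 * n + 1)) (𝓡 (2 * n)) π₂ (F x)
        (mfderiv (𝓡 (2 * n + 1)) (𝓡 (2 * n + 1)) F x u) : EuclideanSpace ℝ (Fin (2 * n))) =
      mfderiv (𝓡 (2 * n)) (𝓡 (2 * n)) φ (π₁ x)
        (mfderiv (𝓡 (2 * n + 1)) (𝓡 (2 * n)) π₁ x u) := by
    intro x hx u
    obtain ⟨hxU, hxφ, hFU, -⟩ := hU x hx
    have hev : π₂ ∘ F =ᶠ[𝓝 x] fun x => φ (π₁ x) := by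
      filter_upwards [F.open_source.mem_nhds hx] with y hy using (hU y hy).2.2.2
    have h3 := DFunLike.congr_fun
      (_root_.mfderiv_comp x (H₂.mdifferentiableAt hFU) (hFd x hx)) u
    have h4 := H₁.mfderiv_comp hφ hxU hxφ u
    have h5 : (mfderiv (𝓡 (2 * n + 1)) (𝓡 (2 * n)) (π₂ ∘ F) x :
        EuclideanSpace ℝ (Fin (2 * n + 1)) →L[ℝ] EuclideanSpace ℝ (Fin (2 * n))) =
        mfderiv (𝓡 (2 * n + 1)) (𝓡 (2 * n)) (fun x => φ (π₁ x)) x := hev.mfderiv_eq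
    exact h3.symm.trans ((DFunLike.congr_fun h5 u).trans h4)
  -- Both distributions are kernels of the contact forms, and `F` pulls `α₂` back to `α₁`.
  have hD : ∀ x ∈ F.source, ∀ u : TangentSpace (𝓡 (2 * n + 1)) x,
      mfderiv (𝓡 (2 * n + 1)) (𝓡 (2 * n + 1)) F x u ∈ S₂.D (F x) ↔ u ∈ S₁.D x := by
    intro x hx u
    rw [H₂.mem_D_iff (hU x hx).2.2.1, H₁.mem_D_iff (hU x hx).1, hform x hx u]
  refine ⟨F, ⟨hF, fun x hx => ?_, fun x hx u hu v hv => ?_⟩, hpF, hFp,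
    fun x hx => (hU x hx).1, fun z hz => ?_, fun x hx => ⟨(hU x hx).2.1, (hU x hx).2.2.2⟩⟩
  · ext w
    constructor
    · rintro ⟨u, hu, rfl⟩
      exact (hD x hx u).2 hu
    · intro hw
      obtain ⟨u, rfl⟩ := (hF.bijective_mfderiv hx).surjective w
      exact ⟨u, (hD x hx u).1 hw, rfl⟩
  · obtain ⟨hxU, hxφ, hFU, hFx⟩ := hU x hx
    -- On `D` each metric is the pullback of its projection; `π₂ ∘ F = φ ∘ π₁` then reduces the
    -- claim to `φ^*g₂ = g₁`.
    rw [← hg₂.pullback _ hFU _ ((hD x hx u).2 hu) _ ((hD x hx v).2 hv),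
      ← hg₁.pullback x hxU u hu v hv, ← hφg _ hxφ]
    exact bilin_congr g₂ hFx (hproj x hx u) (hproj x hx v)
  · rw [← F.right_inv hz]
    exact (hU _ (F.map_target hz)).2.2.1

end IsSymmetricQuotient

end LocalIsometry

end SubPseudo

end

theorem theorem4 (n : ℕ)
    {M₁ : Type*} [TopologicalSpace M₁] [T2Space M₁]
    [ChartedSpace (EuclideanSpace ℝ (Fin (2 * n + 1))) M₁] [IsManifold (𝓡 (2 * n + 1)) ∞ M₁]
    {M₂ : Type*} [TopologicalSpace M₂] [T2Space M₂]
    [ChartedSpace (EuclideanSpace ℝ (Fin (2 * n + 1))) M₂] [IsManifold (𝓡 (2 * n + 1)) ∞ M₂]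
    {N₁ : Type*} [TopologicalSpace N₁] [T2Space N₁]
    [ChartedSpace (EuclideanSpace ℝ (Fin (2 * n))) N₁] [IsManifold (𝓡 (2 * n)) ∞ N₁]
    {N₂ : Type*} [TopologicalSpace N₂] [T2Space N₂]
    [ChartedSpace (EuclideanSpace ℝ (Fin (2 * n))) N₂] [IsManifold (𝓡 (2 * n)) ∞ N₂]
    (S₁ : SubPseudo.ContactStructure n M₁) (S₂ : SubPseudo.ContactStructure n M₂)
    (U₁ : Set M₁) (U₂ : Set M₂)
    (α₁ : Π x : M₁, TangentSpace (𝓡 (2 * n + 1)) x →L[ℝ] ℝ)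
    (α₂ : Π x : M₂, TangentSpace (𝓡 (2 * n + 1)) x →L[ℝ] ℝ)
    (X₁ : Π x : M₁, TangentSpace (𝓡 (2 * n + 1)) x)
    (X₂ : Π x : M₂, TangentSpace (𝓡 (2 * n + 1)) x)
    (π₁ : M₁ → N₁) (π₂ : M₂ → N₂)
    (H₁ : SubPseudo.IsSymmetricQuotient S₁ U₁ α₁ X₁ π₁)
    (H₂ : SubPseudo.IsSymmetricQuotient S₂ U₂ α₂ X₂ π₂) :
    (∃! g, SubPseudo.IsMetricProjection S₁ U₁ π₁ g) ∧
    (∃! Ω, SubPseudo.IsOmegaProjection S₁ U₁ α₁ π₁ Ω) ∧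
    (∃! g, SubPseudo.IsMetricProjection S₂ U₂ π₂ g) ∧
    (∃! Ω, SubPseudo.IsOmegaProjection S₂ U₂ α₂ π₂ Ω) ∧
    ∀ g₁ Ω₁ g₂ Ω₂,
      SubPseudo.IsMetricProjection S₁ U₁ π₁ g₁ → SubPseudo.IsOmegaProjection S₁ U₁ α₁ π₁ Ω₁ →
      SubPseudo.IsMetricProjection S₂ U₂ π₂ g₂ → SubPseudo.IsOmegaProjection S₂ U₂ α₂ π₂ Ω₂ →
      ∀ φ : OpenPartialHomeomorph N₁ N₂, SubPseudo.IsDiffeo (m := 2 * n) φ →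
        SubPseudo.PullsBack φ g₂ g₁ → SubPseudo.PullsBack φ Ω₂ Ω₁ →
        ∀ p₁ ∈ U₁, ∀ p₂ ∈ U₂, π₁ p₁ ∈ φ.source → φ (π₁ p₁) = π₂ p₂ →
          ∃ f : OpenPartialHomeomorph M₁ M₂, SubPseudo.IsSubIsometry S₁ S₂ f ∧
            p₁ ∈ f.source ∧ f p₁ = p₂ ∧ f.source ⊆ U₁ ∧ f.target ⊆ U₂ ∧
            ∀ x ∈ f.source, π₁ x ∈ φ.source ∧ π₂ (f x) = φ (π₁ x) :=
  ⟨H₁.existsUnique_metricProjection, H₁.existsUnique_omegaProjection,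
    H₂.existsUnique_metricProjection, H₂.existsUnique_omegaProjection,
    fun _ _ _ _ hg₁ hΩ₁ hg₂ hΩ₂ _ hφ hφg hφΩ _ hp₁ _ hp₂ hpφ hpp =>
      H₁.exists_local_isometry H₂ hg₁ hΩ₁ hg₂ hΩ₂ hφ hφg hφΩ hp₁ hp₂ hpφ hpp⟩
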